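/- Let $\mathcal X,\mathcal Y$ be finite sets and write $\mathbb R^{\mathcal X\times\mathcal Y}$ with its componentwise order. For $f:\mathbb R^{\mathcal X\times\mathcal Y}\to\mathbb R\cup\{\pm\infty\}$ let $f^*(\mu)=\sup_U\{\mu^\top U-f(U)\}$ and $\operatorname{dom} f=\{f<+\infty\}$. A \emph{welfare function} is a convex, proper, lower semicontinuous function $G$ on $\mathbb R^{\mathcal X\times\mathcal Y}$ such that $\operatorname{dom}G^*$ is compact with least element $0$ (all such $G$ are finite-valued). It is \emph{submodular} if $G(p\wedge p')+G(p\vee p')\le G(p)+G(p')$ for all $p,p'\in\operatorname{dom} G$. With the convention $0\cdot\infty=0$, $G$ is extended to $(\mathbb R\cup\{-\infty\})^{\mathcal X\times\mathcal Y}$ by $G(U)=\max_{\mu}\{\mu^\top U-G^*(\mu)\}$, and $\partial G(U)=\{\mu\in\operatorname{dom}G^*: G(U)+G^*(\mu)=\mu^\top U\}$. Given welfare functions $G,H$ and $\alpha,\gamma\in\mathbb R^{\mathcal X\times\mathcal Y}$, a \emph{generalized equilibrium matching} is a triple $(\mu,U,V)$ with $\mu\in\mathbb R^{\mathcal X\times\mathcal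 Y}$ and $U,V\in(\mathbb R\cup\{-\infty\})^{\mathcal X\times\mathcal Y}$ such that $\max\{U-\alpha,V-\gamma\}=0$ componentwise and $\mu\in\partial G(U)\cap\partial H(V)$. Let $n^G,n^H\in\mathbb R^{\mathcal X\times\mathcal Y}$ be upper bounds of $\operatorname{dom}G^*$ and $\operatorname{dom}H^*$ respectively. The \emph{aggregated deferred acceptance algorithm} starts with $\mu^{A,0}=\min(n^G,n^H)$, $\mu^{T,-1}=0$ and iterates, for $k\ge 0$, with arbitrary choices of maximizers, $$\mu^{P,k}\in\operatorname*{argmax}_{\mu^{T,k-1}\le\mu\le\mu^{A,k}}\{\mu^\top\alpha-G^*(\mu)\},\qquad \mu^{T,k}\in\operatorname*{argmax}_{\mu\le\mu^{P,k}}\{\mu^\top\gamma-H^*(\mu)\},$$ $$\mu^{A,k+1}=\mu^{A,k}-(\mu^{P,k}-\mu^{T,k}),$$ where an argmax consists of points with finite objective value. Let $$T^G(\alpha,\bar\mu)=\operatorname*{argmax}_{\tau\in[0,+\infty]^{\mathcal X\times\mathcal Y}}\{\bar\mu^\top(\alpha-\tau)-G(\alpha-\tau)\},$$ define $T^H$ likewise,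 and put $\tau^{P,k}=\inf T^G(\alpha,\mu^{A,k})$ and $\tau^{T,k}=\inf T^H(\gamma,\mu^{P,k})$ (componentwise infima). \textbf{Theorem.} Let $G,H$ be submodular welfare functions and $\alpha,\gamma\in\mathbb R^{\mathcal X\times\mathcal Y}$. For all $n^G,n^H$ as above: (1) The algorithm is well defined: at every step, whatever maximizers were chosen before, the argmax sets of the proposal and disposal phases are non-empty, and the sets $T^G(\alpha,\mu^{A,k})$, $T^H(\gamma,\mu^{P,k})$ are non-empty and contain their componentwise infima. In particular, infinite runs exist. (2) For every infinite run, the sequence $(\mu^{P,k},\tau^{P,k},\tau^{T,k})_k$ has a convergent subsequence, with limit in $\mathbb R^{\mathcal X\times\mathcal Y}\times[0,+\infty]^{\mathcal X\times\mathcal Y}\times[0,+\infty]^{\mathcal X\times\mathcal Y}$. (3) For every infinite run and every limit $(\mu,\tau^P,\tau^T)$ of a convergent subsequence, the triple $(\mu,\alpha-\tau^\alpha,\gamma-\tau^\gamma)$ is a generalized equilibrium matching, where $\tau^\alpha_{xy}=\tau^P_{xy}$ if $\mu_{xy}<n^G_{xy}$ and $\tau^\alpha_{xy}=0$ otherwise,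 and $\tau^\gamma_{xy}=\tau^T_{xy}$ if $\mu_{xy}<n^H_{xy}$ and $\tau^\gamma_{xy}=0$ otherwise. In particular, a generalized equilibrium matching between $G$ and $H$ with initial preferences $\alpha,\gamma$ exists. -/

import Mathlib

open Filter Topology

namespace AggDA

noncomputable section

/-- Effective domain of an extended-real-valued function. -/
def dom {ι : Type*} (f : (ι → ℝ) → EReal) : Set (ι → ℝ) := {x | f x < ⊤}

/-- Convexity of an extended-real-valued function: its epigraph is convex. -/
def IsConvex {ι : Type*} (f : (ι → ℝ) → EReal) : Prop :=
  Convex ℝ {z : (ι → ℝ) × ℝ | f z.1 ≤ (z.2 : EReal)}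

/-- A function is proper if it never takes the value `-∞` and is finite somewhere. -/
def IsProper {ι : Type*} (f : (ι → ℝ) → EReal) : Prop :=
  (∀ x, f x ≠ ⊥) ∧ (dom f).Nonempty

/-- Legendre transform (convex conjugate) `f*(μ) = sup_U (μ · U - f(U))`. -/
def conj {ι : Type*} [Fintype ι] (f : (ι → ℝ) → EReal) (μ : ι → ℝ) : EReal :=
  ⨆ U : ι → ℝ, ((∑ i, μ i * U i : ℝ) : EReal) - f U

/-- Submodularity with respect to the componentwise lattice operations. -/
def IsSubmodular {ι : Type*} (f : (ι → ℝ) → EReal) : Prop :=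
  ∀ p ∈ dom f, ∀ p' ∈ dom f, f (p ⊓ p') + f (p ⊔ p') ≤ f p + f p'

/-- Welfare functions: convex, proper, lower semicontinuous functions `G` such that `dom G*` is
compact with least element `0` for the componentwise order. -/
structure IsWelfare {ι : Type*} [Fintype ι] (G : (ι → ℝ) → EReal) : Prop where
  convex : IsConvex G
  proper : IsProper G
  lsc : LowerSemicontinuous G
  compact_dom : IsCompact (dom (conj G))
  isLeast_zero : IsLeast (dom (conj G)) 0

/-- The pairing `μ · U` of a real vector with an extended-real vector, with `0 * (-∞) = 0`. -/
def pairing {ι : Type*} [Fintype ι] (μ : ι → ℝ) (U : ι → EReal) : EReal :=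
  ∑ i, (μ i : EReal) * U i

/-- Extension of a welfare function to vectors with entries in `ℝ ∪ {-∞}`:
`G(U) = max_μ (μ · U - G*(μ))`. Only vectors without entry `+∞` are relevant. -/
def ext {ι : Type*} [Fintype ι] (G : (ι → ℝ) → EReal) (U : ι → EReal) : EReal :=
  ⨆ μ : ι → ℝ, pairing μ U - conj G μ

/-- The subdifferential `∂G(U)` at a vector `U` with entries in `ℝ ∪ {-∞}`: all `μ ∈ dom G*` with
`G*(μ) + G(U) = μ · U`. -/
def subdiff {ι : Type*} [Fintype ι] (G : (ι → ℝ) → EReal) (U : ι → EReal) : Set (ι → ℝ) :=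
  {μ | μ ∈ dom (conj G) ∧ conj G μ + ext G U = pairing μ U}

/-- The maximizers of `F` over `S`. If `F` is identically `-∞` on `S`, there is none. -/
def argmaxOn {β : Type*} (S : Set β) (F : β → EReal) : Set β :=
  {x | x ∈ S ∧ F x ≠ ⊥ ∧ ∀ y ∈ S, F y ≤ F x}

/-- The objective `μ · α - G*(μ)`. -/
def objective {ι : Type*} [Fintype ι] (G : (ι → ℝ) → EReal) (α : ι → ℝ) (μ : ι → ℝ) : EReal :=
  ((∑ i, μ i * α i : ℝ) : EReal) - conj G μ

/-- Proposal phase: `argmax_{lo ≤ μ ≤ hi} μ · α - G*(μ)`. -/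
def proposals {ι : Type*} [Fintype ι] (G : (ι → ℝ) → EReal) (α lo hi : ι → ℝ) : Set (ι → ℝ) :=
  argmaxOn {μ | lo ≤ μ ∧ μ ≤ hi} (objective G α)

/-- Disposal phase: `argmax_{μ ≤ hi} μ · γ - H*(μ)`. -/
def disposals {ι : Type*} [Fintype ι] (H : (ι → ℝ) → EReal) (γ hi : ι → ℝ) : Set (ι → ℝ) :=
  argmaxOn {μ | μ ≤ hi} (objective H γ)

/-- The vector `α - τ`, for real `α` and `τ` with entries in `[0, +∞]`. -/
def reduce {ι : Type*} (α : ι → ℝ) (τ : ι → EReal) : ι → EReal := fun i => (α i : EReal) - τ i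

/-- The set of Lagrange multipliers
`T^G(α, m) = argmax_{τ ∈ [0, +∞]^ι} m · (α - τ) - G(α - τ)`. -/
def multipliers {ι : Type*} [Fintype ι] (G : (ι → ℝ) → EReal) (α m : ι → ℝ) : Set (ι → EReal) :=
  argmaxOn {τ | 0 ≤ τ} (fun τ => pairing m (reduce α τ) - ext G (reduce α τ))

/-- The componentwise infimum of `T^G(α, m)`. -/
def leastMultiplier {ι : Type*} [Fintype ι] (G : (ι → ℝ) → EReal) (α m : ι → ℝ) : ι → EReal :=
  sInf (multipliers G α m)

/-- `Reachable G H α γ nG nH A T`: after finitely many (possibly zero) complete rounds, for some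
choice of maximizers, the algorithm may enter the next round with available offers `A`, the offers
retained in the previous round being `T` (`T = 0` at the start). -/
inductive Reachable {ι : Type*} [Fintype ι] (G H : (ι → ℝ) → EReal) (α γ nG nH : ι → ℝ) :
    (ι → ℝ) → (ι → ℝ) → Prop
  | init : Reachable G H α γ nG nH (nG ⊓ nH) 0
  | round {A T P T' : ι → ℝ} : Reachable G H α γ nG nH A T → P ∈ proposals G α T A →
      T' ∈ disposals H γ P → Reachable G H α γ nG nH (A - (P - T')) T'

/-- The sequence `μT` delayed by one step, starting with `0`. -/
def delayed {ι : Type*} (μT : ℕ → ι → ℝ) : ℕ → ι → ℝ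
  | 0 => 0
  | k + 1 => μT k

/-- `(μA, μP, μT)` is a sequence of iterates of the aggregated deferred acceptance algorithm. -/
structure IsRun {ι : Type*} [Fintype ι] (G H : (ι → ℝ) → EReal) (α γ nG nH : ι → ℝ)
    (μA μP μT : ℕ → ι → ℝ) : Prop where
  init : μA 0 = nG ⊓ nH
  proposal : ∀ k, μP k ∈ proposals G α (delayed μT k) (μA k)
  disposal : ∀ k, μT k ∈ disposals H γ (μP k)
  update : ∀ k, μA (k + 1) = μA k - (μP k - μT k)

/-- Generalized equilibrium matchings `(μ, U, V)` between the welfare functions `G` and `H`, with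
initial preferences `α` and `γ`; `U` and `V` have entries in `ℝ ∪ {-∞}`. -/
structure IsGenEquilibrium {ι : Type*} [Fintype ι] (G H : (ι → ℝ) → EReal) (α γ : ι → ℝ)
    (μ : ι → ℝ) (U V : ι → EReal) : Prop where
  U_ne_top : ∀ i, U i ≠ ⊤
  V_ne_top : ∀ i, V i ≠ ⊤
  max_eq_zero : ∀ i, max (U i - (α i : EReal)) (V i - (γ i : EReal)) = 0
  mem_subdiff : μ ∈ subdiff G U ∩ subdiff H V

end

end AggDA

namespace AggDA

/-! By duality, submodularity of `G` becomes an exchange property of `G*` (`exists_exchange`, a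
minimax argument), a divisible form of gross substitutes. It has two uses. First, a retained amount
can be chosen again from a smaller supply (`exists_disposal_ge`), so the lower bound in the proposal
phase costs nothing and every proposal solves the problem constrained only from above. Second, it
makes the extension of `G` to entries `-∞` submodular, so multiplier sets are closed under meets and
their least elements decrease in the capacity.

Strong duality (`mem_subdiff_of_mem_multipliers`) then puts proposals and disposals in the
subdifferentials at multiplier-adjusted prices, with complementary slackness. Along a run the
available offers decrease, so `τ^P` increases. As `μ^{T,k} ≤ μ^{P,k+1}`, and `τ^{T,k}` is also a
multiplier for the capacity `μ^{T,k}`, the sequence `τ^T` decreases. Rejections are the decrements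
of a convergent sequence and vanish, so `μ^P` and `μ^T` share their limits, and the closed graph of
the subdifferential passes optimality to the limit.

If both limit multipliers are positive at a coordinate, nothing is ever rejected there and
eventually, along the subsequence, everything available is proposed. Then `μ` equals `min(n^G, n^H)`
there, and one of the two multipliers gets erased. Erasing it is harmless (`mem_subdiff_indicator`):
no competitor exceeds `μ` at that coordinate. -/

/-- A minimax principle with a real level: if every response `y` can be countered at level `t`,
then some `x` counters all of them. -/
theorem exists_forall_le_of_forall_exists_le {E F : Type*}
    [TopologicalSpace E] [AddCommGroup E] [Module ℝ E] [IsTopologicalAddGroup E]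
    [ContinuousSMul ℝ E] [TopologicalSpace F] [AddCommGroup F] [Module ℝ F]
    [IsTopologicalAddGroup F] [ContinuousSMul ℝ F] {X : Set E} {Y : Set F} {f : E → F → ℝ}
    (ne_X : X.Nonempty) (kX : IsCompact X) (cX : Convex ℝ X) (cY : Convex ℝ Y)
    (hfy : ∀ y ∈ Y, LowerSemicontinuousOn (fun x => f x y) X)
    (hfy' : ∀ y ∈ Y, ConvexOn ℝ X fun x => f x y)
    (hfx : ∀ x ∈ X, UpperSemicontinuousOn (fun y => f x y) Y)
    (hfx' : ∀ x ∈ X, ConcaveOn ℝ Y fun y => f x y)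
    {t : ℝ} (h : ∀ y ∈ Y, ∃ x ∈ X, f x y ≤ t) :
    ∃ x ∈ X, ∀ y ∈ Y, f x y ≤ t := by
  by_contra! hcon
  have hemp : X ∩ ⋂ y ∈ Y, (fun x => f x y) ⁻¹' Set.Iic t = ∅ := by
    rw [Set.eq_empty_iff_forall_notMem]
    rintro x ⟨hx, hx'⟩
    obtain ⟨y, hy, hlt⟩ := hcon x hx
    simp only [Set.mem_iInter, Set.mem_preimage, Set.mem_Iic] at hx'
    exact absurd (hx' y hy) (not_le.2 hlt)
  -- Compactness reduces the empty intersection of sublevel sets to finitely many `y`; Sion's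
  -- theorem then merges these into a single `y` with `f x y > t` on all of `X`.
  obtain ⟨u, hu⟩ := (LowerSemicontinuousOn.inter_biInter_preimage_Iic_eq_empty_iff_exists_finset
    (f := fun y x => f x y) kX hfy).1 hemp
  have hu' : ∀ x ∈ X, ∃ y ∈ Subtype.val '' (u : Set Y), t < f x y := by
    intro x hx
    obtain ⟨i, hi, hlt⟩ := hu x hx
    exact ⟨i, ⟨i, hi, rfl⟩, hlt⟩
  obtain ⟨y, hy, hlt⟩ := Sion.exists_lt_iInf_of_lt_iInf_of_finite ne_X kX hfy
    (fun y hy => (hfy' y hy).quasiconvexOn) cY hfx (fun x hx => (hfx' x hx).quasiconcaveOn) cX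
    (Set.toFinite (Subtype.val '' (u : Set Y))) (Subtype.coe_image_subset _ _) hu'
  obtain ⟨x, hx, hle⟩ := h y hy
  exact absurd hle (not_le.2 (hlt x hx))

/-! ### Real-valued versions of extended-valued functions on their domains. -/

theorem coe_toReal_of_mem_dom {ι : Type*} {g : (ι → ℝ) → EReal} (hbot : ∀ x, g x ≠ ⊥) {x : ι → ℝ}
    (hx : x ∈ dom g) : ((g x).toReal : EReal) = g x :=
  EReal.coe_toReal (ne_of_lt hx) (hbot x)

theorem lowerSemicontinuousOn_toReal {ι : Type*} {g : (ι → ℝ) → EReal} (hbot : ∀ x, g x ≠ ⊥)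
    (hg : LowerSemicontinuous g) : LowerSemicontinuousOn (fun x => (g x).toReal) (dom g) := by
  intro x hx c hc
  have hc' : (c : EReal) < g x := by
    rw [← coe_toReal_of_mem_dom hbot hx]
    exact_mod_cast hc
  filter_upwards [mem_nhdsWithin_of_mem_nhds (hg x c hc'), self_mem_nhdsWithin] with y hy hyd
  rw [gt_iff_lt, ← coe_toReal_of_mem_dom hbot hyd] at hy
  exact_mod_cast hy

theorem convexOn_toReal {ι : Type*} {g : (ι → ℝ) → EReal} (hbot : ∀ x, g x ≠ ⊥)
    (hg : IsConvex g) : ConvexOn ℝ (dom g) (fun x => (g x).toReal) := by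
  have key : ∀ x ∈ dom g, ∀ y ∈ dom g, ∀ a b : ℝ, 0 ≤ a → 0 ≤ b → a + b = 1 →
      g (a • x + b • y) ≤ ((a * (g x).toReal + b * (g y).toReal : ℝ) : EReal) := by
    intro x hx y hy a b ha hb hab
    exact hg (x := (x, (g x).toReal)) (coe_toReal_of_mem_dom hbot hx).ge
      (y := (y, (g y).toReal)) (coe_toReal_of_mem_dom hbot hy).ge ha hb hab
  have hconv : Convex ℝ (dom g) := fun x hx y hy a b ha hb hab =>
    (key x hx y hy a b ha hb hab).trans_lt (EReal.coe_lt_top _)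
  refine ⟨hconv, fun x hx y hy a b ha hb hab => ?_⟩
  have h := key x hx y hy a b ha hb hab
  rw [← coe_toReal_of_mem_dom hbot (hconv hx hy ha hb hab)] at h
  exact_mod_cast h

theorem IsSubmodular.toReal_le {ι : Type*} {G : (ι → ℝ) → EReal} (hG : IsProper G)
    (hs : IsSubmodular G) {p q : ι → ℝ}
    (hp : p ∈ dom G) (hq : q ∈ dom G) : p ⊓ q ∈ dom G ∧ p ⊔ q ∈ dom G ∧
      (G (p ⊓ q)).toReal + (G (p ⊔ q)).toReal ≤ (G p).toReal + (G q).toReal := by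
  have h := hs p hp q hq
  rw [← coe_toReal_of_mem_dom hG.1 hp, ← coe_toReal_of_mem_dom hG.1 hq, ← EReal.coe_add] at h
  have hlt := h.trans_lt (EReal.coe_lt_top _)
  have h1 : p ⊓ q ∈ dom G := by
    rw [dom, Set.mem_ofPred_eq, lt_top_iff_ne_top]
    intro e
    rw [e, EReal.top_add_of_ne_bot (hG.1 _)] at hlt
    exact lt_irrefl _ hlt
  have h2 : p ⊔ q ∈ dom G := by
    rw [dom, Set.mem_ofPred_eq, lt_top_iff_ne_top]
    intro e
    rw [e, EReal.add_top_of_ne_bot (hG.1 _)] at hlt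
    exact lt_irrefl _ hlt
  refine ⟨h1, h2, ?_⟩
  rw [← coe_toReal_of_mem_dom hG.1 h1, ← coe_toReal_of_mem_dom hG.1 h2] at h
  exact_mod_cast h

/-! ### Conjugates and the exchange property. -/

section Conjugate

variable {ι : Type*} [Fintype ι] {G : (ι → ℝ) → EReal}

/-- Points where `G` is `⊤` contribute `-∞` to the supremum, so real inequalities on `dom G`
suffice. -/
theorem conj_le_coe_iff (hG : IsProper G) {μ : ι → ℝ} {c : ℝ} :
    conj G μ ≤ (c : EReal) ↔ ∀ U ∈ dom G, ∑ i, μ i * U i - (G U).toReal ≤ c := by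
  unfold conj
  rw [iSup_le_iff]
  refine forall_congr' fun U => ?_
  by_cases hU : U ∈ dom G
  · rw [← coe_toReal_of_mem_dom hG.1 hU]
    simp only [hU, forall_true_left, EReal.toReal_coe]
    exact_mod_cast Iff.rfl
  · have : G U = ⊤ := not_lt_top_iff.1 hU
    simp [this, hU]

theorem conj_ne_bot (hG : IsProper G) (μ : ι → ℝ) : conj G μ ≠ ⊥ := by
  intro h
  obtain ⟨U, hU⟩ := hG.2
  have := (conj_le_coe_iff hG (c := ∑ i, μ i * U i - (G U).toReal - 1)).1 (h ▸ bot_le) U hU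
  linarith

theorem lowerSemicontinuous_conj : LowerSemicontinuous (conj G) := by
  refine lowerSemicontinuous_iSup fun U => Continuous.lowerSemicontinuous ?_
  by_cases hb : G U = ⊥
  · simp only [hb, EReal.coe_sub_bot]
    exact continuous_const
  by_cases ht : G U = ⊤
  · simp only [ht, EReal.sub_top]
    exact continuous_const
  · lift G U to ℝ using ⟨ht, hb⟩ with r
    exact continuous_coe_real_ereal.comp
      (f := fun μ : ι → ℝ => ∑ i, μ i * U i - r) (by fun_prop)

theorem isConvex_conj (hG : IsProper G) : IsConvex (conj G) := by
  intro x hx y hy a b ha hb hab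
  have hx' := (conj_le_coe_iff hG).1 hx
  have hy' := (conj_le_coe_iff hG).1 hy
  refine (conj_le_coe_iff hG).2 fun U hU => ?_
  have e : ∑ i, (a • x + b • y).1 i * U i = a * ∑ i, x.1 i * U i + b * ∑ i, y.1 i * U i := by
    rw [Finset.mul_sum, Finset.mul_sum, ← Finset.sum_add_distrib]
    exact Finset.sum_congr rfl fun i _ => by simp; ring
  have h2 : (a • x + b • y).2 = a * x.2 + b * y.2 := rfl
  have hr : (G U).toReal = a * (G U).toReal + b * (G U).toReal := by rw [← add_mul, hab, one_mul]
  rw [e, h2, hr]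
  nlinarith [mul_le_mul_of_nonneg_left (hx' U hU) ha, mul_le_mul_of_nonneg_left (hy' U hU) hb]

theorem mem_dom_conj_of_le (hG : IsProper G) {μ : ι → ℝ} {c : ℝ}
    (h : ∀ U ∈ dom G, ∑ i, μ i * U i - (G U).toReal ≤ c) :
    μ ∈ dom (conj G) ∧ (conj G μ).toReal ≤ c := by
  have h' := (conj_le_coe_iff hG).2 h
  have hd : μ ∈ dom (conj G) := h'.trans_lt (EReal.coe_lt_top _)
  rw [← coe_toReal_of_mem_dom (conj_ne_bot hG) hd] at h'
  exact ⟨hd, by exact_mod_cast h'⟩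

theorem le_toReal_conj (hG : IsProper G) {μ U : ι → ℝ} (hμ : μ ∈ dom (conj G)) (hU : U ∈ dom G) :
    ∑ i, μ i * U i - (G U).toReal ≤ (conj G μ).toReal :=
  (conj_le_coe_iff hG).1 (coe_toReal_of_mem_dom (conj_ne_bot hG) hμ).ge U hU

/-- The conjugate of a submodular function satisfies an exchange property. -/
theorem exists_exchange (hc : IsConvex G) (hG : IsProper G) (hl : LowerSemicontinuous G)
    (hs : IsSubmodular G) {x y δ : ι → ℝ} (hx : x ∈ dom (conj G)) (hy : y ∈ dom (conj G))
    (hδ0 : ∀ i, 0 ≤ δ i) (hδ : ∀ i, δ i ≤ max (x i - y i) 0) :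
    ∃ ε : ι → ℝ, (∀ i, 0 ≤ ε i) ∧ (∀ i, ε i ≤ max (y i - x i) 0) ∧
      x - δ + ε ∈ dom (conj G) ∧ y + δ - ε ∈ dom (conj G) ∧
      (conj G (x - δ + ε)).toReal + (conj G (y + δ - ε)).toReal
        ≤ (conj G x).toReal + (conj G y).toReal := by
  classical
  set m : ι → ℝ := fun i => max (y i - x i) 0 with hm
  have hm0 : (0 : ι → ℝ) ≤ m := fun i => le_max_right _ _
  have hgc := convexOn_toReal hG.1 hc
  have hgl := lowerSemicontinuousOn_toReal hG.1 hl
  obtain ⟨U₀, hU₀⟩ := hG.2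
  -- The supremum of `F ε` over `dom G ×ˢ dom G` is the left side of the exchange inequality. `F` is
  -- affine in `ε` and concave in the pair, so minimax allows `ε` to be chosen after `(U, V)`.
  let F : (ι → ℝ) → (ι → ℝ) × (ι → ℝ) → ℝ := fun ε z =>
    (∑ i, (x i - δ i + ε i) * z.1 i + ∑ i, (y i + δ i - ε i) * z.2 i)
      + (-(G z.1).toReal + -(G z.2).toReal)
  have key : ∃ ε ∈ Set.Icc (0 : ι → ℝ) m, ∀ z ∈ dom G ×ˢ dom G,
      F ε z ≤ (conj G x).toReal + (conj G y).toReal := by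
    refine exists_forall_le_of_forall_exists_le (Set.nonempty_Icc.2 hm0) isCompact_Icc
      (convex_Icc _ _)
      (hgc.1.prod hgc.1) ?_ ?_ ?_ ?_ ?_
    · intro z _
      exact (show Continuous fun ε => F ε z by fun_prop).lowerSemicontinuous.lowerSemicontinuousOn _
    · intro z _
      refine ⟨convex_Icc _ _, fun a _ b _ s t hs ht hst => le_of_eq ?_⟩
      have hr : t = 1 - s := by linarith
      simp only [F, smul_eq_mul, hr, Pi.add_apply, Pi.smul_apply]
      have e1 : ∑ i, (x i - δ i + (s * a i + (1 - s) * b i)) * z.1 i =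
        s * ∑ i, (x i - δ i + a i) * z.1 i + (1 - s) * ∑ i, (x i - δ i + b i) * z.1 i := by
        rw [Finset.mul_sum, Finset.mul_sum, ← Finset.sum_add_distrib]
        exact Finset.sum_congr rfl fun i _ => by ring
      have e2 : ∑ i, (y i + δ i - (s * a i + (1 - s) * b i)) * z.2 i =
        s * ∑ i, (y i + δ i - a i) * z.2 i + (1 - s) * ∑ i, (y i + δ i - b i) * z.2 i := by
        rw [Finset.mul_sum, Finset.mul_sum, ← Finset.sum_add_distrib]
        exact Finset.sum_congr rfl fun i _ => by ring
      rw [e1, e2]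
      ring
    · intro ε _
      refine UpperSemicontinuousOn.add
        ((Continuous.upperSemicontinuous (by fun_prop)).upperSemicontinuousOn _)
        (UpperSemicontinuousOn.add ?_ ?_)
      · intro z hz c hc
        have h1 : -c < (G z.1).toReal := by linarith
        have h2 := hgl z.1 hz.1 _ h1
        have ht : Tendsto Prod.fst (𝓝[dom G ×ˢ dom G] z) (𝓝[dom G] z.1) :=
          continuous_fst.continuousWithinAt.tendsto_nhdsWithin fun w hw => hw.1
        filter_upwards [ht.eventually h2] with w hw
        linarith
      · intro z hz c hc
        have h1 : -c < (G z.2).toReal := by linarith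
        have h2 := hgl z.2 hz.2 _ h1
        have ht : Tendsto Prod.snd (𝓝[dom G ×ˢ dom G] z) (𝓝[dom G] z.2) :=
          continuous_snd.continuousWithinAt.tendsto_nhdsWithin fun w hw => hw.2
        filter_upwards [ht.eventually h2] with w hw
        linarith
    · intro ε _
      refine ⟨hgc.1.prod hgc.1, fun a ha b hb s t hs ht hst => ?_⟩
      have h1 := hgc.2 ha.1 hb.1 hs ht hst
      have h2 := hgc.2 ha.2 hb.2 hs ht hst
      have e : ∀ (v p q : ι → ℝ), ∑ i, v i * (s • p + t • q) i
          = s * ∑ i, v i * p i + t * ∑ i, v i * q i := by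
        intro v p q
        rw [Finset.mul_sum, Finset.mul_sum, ← Finset.sum_add_distrib]
        exact Finset.sum_congr rfl fun i _ => by simp; ring
      have e1 := e (fun i => x i - δ i + ε i) a.1 b.1
      have e2 := e (fun i => y i + δ i - ε i) a.2 b.2
      simp only [F, Prod.fst_add, Prod.snd_add, Prod.smul_fst, Prod.smul_snd]
      rw [e1, e2]
      simp only [smul_eq_mul] at h1 h2 ⊢
      linarith
    · rintro ⟨U, V⟩ ⟨hU, hV⟩
      -- The transfer `ε` goes entirely to the coordinates where `V` exceeds `U`. The linear terms
      -- are then at most `x · (U ⊔ V) + y · (U ⊓ V)`, and submodularity with Fenchel's inequality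
      -- at `x` and `y` concludes.
      refine ⟨fun i => if U i < V i then m i else 0, ⟨fun i => ?_, fun i => ?_⟩, ?_⟩
      · dsimp only
        split_ifs
        exacts [hm0 i, le_rfl]
      · dsimp only
        split_ifs
        exacts [le_rfl, hm0 i]
      obtain ⟨h1, h2, h3⟩ := hs.toReal_le hG hU hV
      have h4 := le_toReal_conj hG hx h2
      have h5 := le_toReal_conj hG hy h1
      have h6 : ∑ i, (x i - δ i + if U i < V i then m i else 0) * U i
          + ∑ i, (y i + δ i - if U i < V i then m i else 0) * V i
          ≤ ∑ i, x i * (U ⊔ V) i + ∑ i, y i * (U ⊓ V) i := by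
        rw [← Finset.sum_add_distrib, ← Finset.sum_add_distrib]
        refine Finset.sum_le_sum fun i _ => ?_
        have hδ0i := hδ0 i
        have hδi := hδ i
        simp only [Pi.sup_apply, Pi.inf_apply, hm]
        split_ifs with hlt
        · rw [sup_eq_right.2 hlt.le, inf_eq_left.2 hlt.le]
          rcases le_total (x i) (y i) with hxy | hxy
          · rw [max_eq_right (by linarith)] at hδi
            rw [max_eq_left (by linarith)]
            have : δ i = 0 := le_antisymm hδi hδ0i
            rw [this]
            linarith
          · rw [max_eq_left (by linarith)] at hδi
            rw [max_eq_right (by linarith)]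
            nlinarith [mul_nonneg (sub_nonneg.2 hδi) (sub_nonneg.2 hlt.le)]
        · rw [not_lt] at hlt
          rw [sup_eq_left.2 hlt, inf_eq_right.2 hlt]
          nlinarith [mul_nonneg hδ0i (sub_nonneg.2 hlt)]
      simp only [F]
      linarith
  obtain ⟨ε, ⟨hε0, hεm⟩, hF⟩ := key
  -- Freezing the first argument at `U₀` shows that the second conjugate is finite; only then can
  -- the joint bound be split into a sum of two real suprema.
  have hxε : ∀ V ∈ dom G, ∑ i, (x - δ + ε) i * U₀ i - (G U₀).toReal
      + (∑ i, (y + δ - ε) i * V i - (G V).toReal) ≤ (conj G x).toReal + (conj G y).toReal := by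
    intro V hV
    have := hF (U₀, V) ⟨hU₀, hV⟩
    simp only [F] at this
    simp only [Pi.add_apply, Pi.sub_apply]
    linarith
  have hyd : y + δ - ε ∈ dom (conj G) := (mem_dom_conj_of_le hG (c := (conj G x).toReal
    + (conj G y).toReal - (∑ i, (x - δ + ε) i * U₀ i - (G U₀).toReal)) fun V hV => by
      linarith [hxε V hV]).1
  have hx' : x - δ + ε ∈ dom (conj G) ∧ (conj G (x - δ + ε)).toReal ≤
      (conj G x).toReal + (conj G y).toReal - (conj G (y + δ - ε)).toReal := by
    refine mem_dom_conj_of_le hG fun U hU => ?_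
    have := (mem_dom_conj_of_le hG (μ := y + δ - ε) (c := (conj G x).toReal
      + (conj G y).toReal - (∑ i, (x - δ + ε) i * U i - (G U).toReal)) fun V hV => by
        have := hF (U, V) ⟨hU, hV⟩
        simp only [F] at this
        simp only [Pi.add_apply, Pi.sub_apply]
        linarith).2
    linarith
  exact ⟨ε, hε0, hεm, hx'.1, hyd, by linarith [hx'.2]⟩

end Conjugate

/-! ### Pairings with vectors having entries `-∞`. -/

section Pairing

variable {ι : Type*}

/-- `ν` vanishes wherever `U` is `-∞`, that is, `ν · U` is finite. -/
def VanishesAtBot (ν : ι → ℝ) (U : ι → EReal) : Prop := ∀ i, U i = ⊥ → ν i = 0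

/-- The pairing of `ν` with the finite entries of `U`. -/
noncomputable def realPairing [Fintype ι] (ν : ι → ℝ) (U : ι → EReal) : ℝ :=
  ∑ i, ν i * (U i).toReal

theorem coe_finset_sum (s : Finset ι) (f : ι → ℝ) :
    ((∑ i ∈ s, f i : ℝ) : EReal) = ∑ i ∈ s, (f i : EReal) := by
  classical
  induction s using Finset.induction_on with
  | empty => simp
  | insert a s ha ih => rw [Finset.sum_insert ha, Finset.sum_insert ha, EReal.coe_add, ih]

theorem VanishesAtBot.coe_mul_eq {ν : ι → ℝ} {U : ι → EReal} (h : VanishesAtBot ν U)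
    (hU : ∀ i, U i ≠ ⊤) (i : ι) : (ν i : EReal) * U i = ((ν i * (U i).toReal : ℝ) : EReal) := by
  by_cases hb : U i = ⊥
  · simp [h i hb]
  · rw [EReal.coe_mul, EReal.coe_toReal (hU i) hb]

theorem VanishesAtBot.pairing_eq [Fintype ι] {ν : ι → ℝ} {U : ι → EReal} (h : VanishesAtBot ν U)
    (hU : ∀ i, U i ≠ ⊤) : pairing ν U = (realPairing ν U : EReal) := by
  rw [realPairing, coe_finset_sum]
  exact Finset.sum_congr rfl fun i _ => h.coe_mul_eq hU i

theorem pairing_eq_bot [Fintype ι] {ν : ι → ℝ} {U : ι → EReal} (hν : 0 ≤ ν) (h : ¬ VanishesAtBot ν U) :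
    pairing ν U = ⊥ := by
  classical
  simp only [VanishesAtBot, not_forall] at h
  obtain ⟨i, hi, hνi⟩ := h
  -- One term `⊥` absorbs the whole sum, since `⊥ + ⊤ = ⊥` in `EReal`.
  rw [pairing, ← Finset.add_sum_erase _ _ (Finset.mem_univ i), hi,
    EReal.coe_mul_bot_of_pos (lt_of_le_of_ne (hν i) (Ne.symm hνi)), EReal.bot_add]

theorem vanishesAtBot_coe (ν u : ι → ℝ) : VanishesAtBot ν (fun i => (u i : EReal)) :=
  fun _ h => absurd h (EReal.coe_ne_bot _)

theorem vanishesAtBot_zero (U : ι → EReal) : VanishesAtBot 0 U := fun _ _ => rfl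

theorem tendsto_finset_sum_ereal {α : Type*} {l : Filter α} {f : ι → α → EReal} {a : ι → EReal}
    (s : Finset ι) (h : ∀ i ∈ s, Tendsto (f i) l (𝓝 (a i))) (ha : ∀ i ∈ s, a i ≠ ⊤) :
    Tendsto (fun x => ∑ i ∈ s, f i x) l (𝓝 (∑ i ∈ s, a i)) ∧ ∑ i ∈ s, a i ≠ ⊤ := by
  classical
  induction s using Finset.induction_on with
  | empty => simp [tendsto_const_nhds]
  | insert j s hj ih =>
    obtain ⟨h1, h2⟩ := ih (fun i hi => h i (Finset.mem_insert_of_mem hi))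
      (fun i hi => ha i (Finset.mem_insert_of_mem hi))
    have hj' := ha j (Finset.mem_insert_self _ _)
    simp only [Finset.sum_insert hj]
    refine ⟨?_, EReal.add_ne_top hj' h2⟩
    exact (EReal.continuousAt_add (p := (a j, ∑ i ∈ s, a i)) (Or.inl hj') (Or.inr h2)).tendsto.comp
      ((h j (Finset.mem_insert_self _ _)).prodMk_nhds h1)

end Pairing

/-! ### Prices adjusted by multipliers. -/

section Reduce

variable {ι : Type*} {α : ι → ℝ} {τ τ' : ι → EReal}

theorem reduce_ne_top (hτ : 0 ≤ τ) (i : ι) : reduce α τ i ≠ ⊤ := by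
  have h : τ i ≠ ⊥ := fun h => absurd (h ▸ hτ i : (0 : EReal) ≤ ⊥) (by simp)
  rw [reduce, sub_eq_add_neg]
  exact EReal.add_ne_top (EReal.coe_ne_top _) (by simpa using h)

theorem reduce_eq_bot_iff (i : ι) : reduce α τ i = ⊥ ↔ τ i = ⊤ := by
  rw [reduce, sub_eq_add_neg, EReal.add_eq_bot_iff]
  simp

theorem toReal_reduce {i : ι} (h0 : 0 ≤ τ) (h : τ i ≠ ⊤) :
    (reduce α τ i).toReal = α i - (τ i).toReal := by
  have h' : τ i ≠ ⊥ := fun h => absurd (h ▸ h0 i : (0 : EReal) ≤ ⊥) (by simp)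
  rw [reduce, EReal.toReal_sub (EReal.coe_ne_top _) (EReal.coe_ne_bot _) h h', EReal.toReal_coe]

theorem reduce_inf : reduce α (τ ⊓ τ') = reduce α τ ⊔ reduce α τ' := by
  funext i
  have hanti : Antitone fun t : EReal => (α i : EReal) - t :=
    fun a b hab => EReal.sub_le_sub le_rfl hab
  exact hanti.map_inf (τ i) (τ' i)

theorem reduce_sup : reduce α (τ ⊔ τ') = reduce α τ ⊓ reduce α τ' := by
  funext i
  have hanti : Antitone fun t : EReal => (α i : EReal) - t :=
    fun a b hab => EReal.sub_le_sub le_rfl hab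
  exact hanti.map_sup (τ i) (τ' i)

theorem reduce_zero : reduce α 0 = fun i => (α i : EReal) := by
  funext i
  simp [reduce]

theorem continuous_reduce : Continuous (reduce α) := by
  refine continuous_pi fun i => ?_
  rw [continuous_iff_continuousAt]
  intro τ
  simp only [reduce, sub_eq_add_neg]
  exact (EReal.continuousAt_add (p := ((α i : EReal), -τ i)) (Or.inl (EReal.coe_ne_top _))
    (Or.inl (EReal.coe_ne_bot _))).comp
    (f := fun τ : ι → EReal => ((α i : EReal), -τ i)) (x := τ)
    (continuousAt_const.prodMk (continuous_neg.comp (continuous_apply i)).continuousAt)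

theorem continuousOn_pairing_reduce [Fintype ι] (ν : ι → ℝ) (hν : 0 ≤ ν) :
    ContinuousOn (fun τ => pairing ν (reduce α τ)) (Set.Ici 0) := by
  intro τ hτ
  refine (tendsto_finset_sum_ereal Finset.univ (a := fun i => (ν i : EReal) * reduce α τ i)
    (fun i _ => ?_) fun i _ => ?_).1
  · exact EReal.Tendsto.const_mul
      (((continuous_apply i).comp continuous_reduce).continuousWithinAt (s := Set.Ici 0) (x := τ))
      (Or.inl (EReal.coe_ne_bot _)) (Or.inl (EReal.coe_ne_top _))
  · by_cases h : ν i = 0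
    · simp [h]
    by_cases hb : reduce α τ i = ⊥
    · rw [hb, EReal.coe_mul_bot_of_pos (lt_of_le_of_ne (hν i) (Ne.symm h))]
      exact bot_ne_top
    · lift reduce α τ i to ℝ using ⟨reduce_ne_top hτ i, hb⟩ with r
      exact_mod_cast EReal.coe_ne_top _

end Reduce

/-! ### The extended welfare function and its submodularity. -/

section Extension

variable {ι : Type*} [Fintype ι] {G : (ι → ℝ) → EReal}

theorem conj_eq_top {μ : ι → ℝ} (hμ : μ ∉ dom (conj G)) : conj G μ = ⊤ :=
  not_lt_top_iff.1 hμ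

theorem IsWelfare.nonneg (hG : IsWelfare G) {μ : ι → ℝ} (hμ : μ ∈ dom (conj G)) : 0 ≤ μ :=
  hG.isLeast_zero.2 hμ

theorem IsWelfare.coe_conj (hG : IsWelfare G) {μ : ι → ℝ} (hμ : μ ∈ dom (conj G)) :
    ((conj G μ).toReal : EReal) = conj G μ :=
  coe_toReal_of_mem_dom (conj_ne_bot hG.proper) hμ

theorem IsWelfare.lsc_conj (hG : IsWelfare G) :
    LowerSemicontinuousOn (fun μ => (conj G μ).toReal) (dom (conj G)) :=
  lowerSemicontinuousOn_toReal (conj_ne_bot hG.proper) lowerSemicontinuous_conj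

theorem IsWelfare.convexOn_conj (hG : IsWelfare G) :
    ConvexOn ℝ (dom (conj G)) (fun μ => (conj G μ).toReal) :=
  convexOn_toReal (conj_ne_bot hG.proper) (isConvex_conj hG.proper)

/-- A linear functional minus `G*` attains its maximum over the points of a closed set in
`dom G*`. -/
theorem IsWelfare.exists_isMax (hG : IsWelfare G) (u : ι → ℝ) {S : Set (ι → ℝ)} (hS : IsClosed S)
    (hne : (dom (conj G) ∩ S).Nonempty) :
    ∃ μ ∈ dom (conj G) ∩ S, ∀ ν ∈ dom (conj G) ∩ S,
      ∑ i, ν i * u i - (conj G ν).toReal ≤ ∑ i, μ i * u i - (conj G μ).toReal := by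
  have hlin : LowerSemicontinuousOn (fun μ : ι → ℝ => -∑ i, μ i * u i) (dom (conj G) ∩ S) :=
    (Continuous.lowerSemicontinuous (by fun_prop)).lowerSemicontinuousOn _
  obtain ⟨μ, hμ, hmin⟩ := LowerSemicontinuousOn.exists_isMinOn hne
    (hG.compact_dom.inter_right hS) ((hG.lsc_conj.mono Set.inter_subset_left).add hlin)
  refine ⟨μ, hμ, fun ν hν => ?_⟩
  have : (conj G μ).toReal + -∑ i, μ i * u i ≤ (conj G ν).toReal + -∑ i, ν i * u i := hmin hν
  linarith

/-- Vectors charging a `-∞` entry of `U` have value `-∞`. The others in `dom G*` form a compact set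
containing `0`, on which the pairing is linear, so the supremum is attained and finite. -/
theorem IsWelfare.exists_ext_eq (hG : IsWelfare G) {U : ι → EReal} (hU : ∀ i, U i ≠ ⊤) :
    ∃ μ ∈ dom (conj G), VanishesAtBot μ U ∧
      ext G U = ((realPairing μ U - (conj G μ).toReal : ℝ) : EReal) := by
  have hS : IsClosed {μ : ι → ℝ | VanishesAtBot μ U} := by
    simp only [VanishesAtBot, Set.ofPred_forall]
    exact isClosed_iInter fun i => isClosed_iInter fun _ =>
      isClosed_eq (continuous_apply i) continuous_const
  obtain ⟨μ, ⟨hμ, hμU⟩, hmax⟩ := hG.exists_isMax (fun i => (U i).toReal) hS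
    ⟨0, hG.isLeast_zero.1, vanishesAtBot_zero U⟩
  refine ⟨μ, hμ, hμU, le_antisymm (iSup_le fun ν => ?_) ?_⟩
  · by_cases hν : ν ∈ dom (conj G)
    · by_cases hνU : VanishesAtBot ν U
      · rw [VanishesAtBot.pairing_eq hνU hU, ← hG.coe_conj hν, ← EReal.coe_sub]
        exact_mod_cast hmax ν ⟨hν, hνU⟩
      · rw [pairing_eq_bot (hG.nonneg hν) hνU, EReal.bot_sub]
        exact bot_le
    · rw [conj_eq_top hν, EReal.sub_top]
      exact bot_le
  · refine le_iSup_of_le μ ?_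
    rw [VanishesAtBot.pairing_eq hμU hU, ← hG.coe_conj hμ, ← EReal.coe_sub, EReal.toReal_coe]

theorem IsWelfare.coe_ext (hG : IsWelfare G) {U : ι → EReal} (hU : ∀ i, U i ≠ ⊤) :
    ((ext G U).toReal : EReal) = ext G U := by
  obtain ⟨μ, _, _, h⟩ := hG.exists_ext_eq hU
  rw [h, EReal.toReal_coe]

theorem IsWelfare.exists_toReal_ext_eq (hG : IsWelfare G) {U : ι → EReal} (hU : ∀ i, U i ≠ ⊤) :
    ∃ μ ∈ dom (conj G), VanishesAtBot μ U ∧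
      (ext G U).toReal = realPairing μ U - (conj G μ).toReal := by
  obtain ⟨μ, hμ, hμU, h⟩ := hG.exists_ext_eq hU
  exact ⟨μ, hμ, hμU, by rw [h, EReal.toReal_coe]⟩

theorem IsWelfare.le_toReal_ext (hG : IsWelfare G) {U : ι → EReal} (hU : ∀ i, U i ≠ ⊤)
    {ν : ι → ℝ} (hν : ν ∈ dom (conj G)) (hνU : VanishesAtBot ν U) :
    realPairing ν U - (conj G ν).toReal ≤ (ext G U).toReal := by
  have h : pairing ν U - conj G ν ≤ ext G U := le_iSup (fun ν => pairing ν U - conj G ν) ν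
  rw [hνU.pairing_eq hU, ← hG.coe_conj hν, ← hG.coe_ext hU, ← EReal.coe_sub] at h
  exact_mod_cast h

theorem IsWelfare.mem_subdiff_iff (hG : IsWelfare G) {U : ι → EReal} (hU : ∀ i, U i ≠ ⊤)
    {μ : ι → ℝ} : μ ∈ subdiff G U ↔ μ ∈ dom (conj G) ∧ VanishesAtBot μ U ∧
      (conj G μ).toReal + (ext G U).toReal ≤ realPairing μ U := by
  constructor
  · rintro ⟨hμ, h⟩
    rw [← hG.coe_conj hμ, ← hG.coe_ext hU, ← EReal.coe_add] at h
    have hμU : VanishesAtBot μ U := by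
      by_contra hc
      rw [pairing_eq_bot (hG.nonneg hμ) hc] at h
      exact EReal.coe_ne_bot _ h
    rw [hμU.pairing_eq hU] at h
    exact ⟨hμ, hμU, le_of_eq (by exact_mod_cast h)⟩
  · rintro ⟨hμ, hμU, h⟩
    refine ⟨hμ, ?_⟩
    rw [← hG.coe_conj hμ, ← hG.coe_ext hU, ← EReal.coe_add, hμU.pairing_eq hU]
    exact_mod_cast le_antisymm h (by linarith [hG.le_toReal_ext hU hμ hμU])

/-- The exchange property gives submodularity back, now with entries `-∞` allowed: optimal vectors
at `U ⊔ V` and `U ⊓ V` are exchanged into test vectors for `U` and `V`. -/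
theorem IsWelfare.toReal_ext_inf_add_sup_le (hG : IsWelfare G) (hs : IsSubmodular G)
    {U V : ι → EReal} (hU : ∀ i, U i ≠ ⊤) (hV : ∀ i, V i ≠ ⊤) :
    (ext G (U ⊓ V)).toReal + (ext G (U ⊔ V)).toReal ≤ (ext G U).toReal + (ext G V).toReal := by
  classical
  have hinf : ∀ i, (U ⊓ V) i ≠ ⊤ := fun i h => hU i (top_le_iff.1 (h ▸ inf_le_left))
  have hsup : ∀ i, (U ⊔ V) i ≠ ⊤ := fun i => by
    rw [Pi.sup_apply]
    rcases le_total (U i) (V i) with h | h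
    · rw [sup_eq_right.2 h]
      exact hV i
    · rw [sup_eq_left.2 h]
      exact hU i
  obtain ⟨x, hx, hxb, hxe⟩ := hG.exists_toReal_ext_eq hsup
  obtain ⟨y, hy, hyb, hye⟩ := hG.exists_toReal_ext_eq hinf
  have hx0 := hG.nonneg hx
  have hy0 := hG.nonneg hy
  -- Moving all the excess of `x` over `y` where `U < V` makes `x - δ + ε ≤ y` there, which is what
  -- the coordinatewise comparison `h3` needs.
  let δ : ι → ℝ := fun i => if U i < V i then max (x i - y i) 0 else 0
  have hδ0 : ∀ i, 0 ≤ δ i := fun i => by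
    dsimp only [δ]
    split_ifs
    exacts [le_max_right _ _, le_rfl]
  have hδ : ∀ i, δ i ≤ max (x i - y i) 0 := fun i => by
    dsimp only [δ]
    split_ifs
    exacts [le_rfl, le_max_right _ _]
  obtain ⟨ε, hε0, hε, hx', hy', hle⟩ :=
    exists_exchange hG.convex hG.proper hG.lsc hs hx hy hδ0 hδ
  have cases_i : ∀ i, (U i < V i ∧ (U ⊔ V) i = V i ∧ (U ⊓ V) i = U i ∧
      δ i = max (x i - y i) 0) ∨ (V i ≤ U i ∧ (U ⊔ V) i = U i ∧ (U ⊓ V) i = V i ∧ δ i = 0) := by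
    intro i
    rcases lt_or_ge (U i) (V i) with h | h
    · exact Or.inl ⟨h, sup_eq_right.2 h.le, inf_eq_left.2 h.le, if_pos h⟩
    · exact Or.inr ⟨h, sup_eq_left.2 h, inf_eq_right.2 h, if_neg (not_lt.2 h)⟩
  have hεz : ∀ i, y i = 0 → ε i = 0 := fun i h => by
    have h1 := hε i
    have hxi : 0 ≤ x i := hx0 i
    rw [h, max_eq_right (by linarith)] at h1
    exact le_antisymm h1 (hε0 i)
  have hxU : VanishesAtBot (x - δ + ε) U := by
    intro i hi
    have hyi : y i = 0 := hyb i (le_bot_iff.1 (hi ▸ inf_le_left))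
    have hxi : 0 ≤ x i := hx0 i
    simp only [Pi.add_apply, Pi.sub_apply, hεz i hyi]
    rcases cases_i i with ⟨_, _, _, h⟩ | ⟨h, h', _, h''⟩
    · rw [h, hyi, max_eq_left (by linarith)]
      ring
    · rw [h'', hxb i (h'.trans hi)]
      ring
  have hyV : VanishesAtBot (y + δ - ε) V := by
    intro i hi
    have hyi : y i = 0 := hyb i (le_bot_iff.1 (hi ▸ inf_le_right))
    simp only [Pi.add_apply, Pi.sub_apply, hεz i hyi, hyi]
    rcases cases_i i with ⟨h, _⟩ | ⟨_, _, _, h⟩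
    · rw [hi] at h
      exact absurd h not_lt_bot
    · rw [h]
      ring
  have h1 := hG.le_toReal_ext hU hx' hxU
  have h2 := hG.le_toReal_ext hV hy' hyV
  have h3 : realPairing x (U ⊔ V) + realPairing y (U ⊓ V)
      ≤ realPairing (x - δ + ε) U + realPairing (y + δ - ε) V := by
    simp only [realPairing]
    rw [← Finset.sum_add_distrib, ← Finset.sum_add_distrib]
    refine Finset.sum_le_sum fun i _ => ?_
    have hεi := hε i
    have hε0i := hε0 i
    have hxi : 0 ≤ x i := hx0 i
    simp only [Pi.add_apply, Pi.sub_apply]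
    rcases cases_i i with ⟨hlt, e1, e2, e3⟩ | ⟨hlt, e1, e2, e3⟩
    · rw [e1, e2, e3]
      by_cases hb : U i = ⊥
      · have hyi : y i = 0 := hyb i (e2.trans hb)
        rw [hεz i hyi, hyi, max_eq_left (by linarith)]
        simp
      · have hlt' := EReal.toReal_le_toReal hlt.le hb (hV i)
        rcases le_total (x i) (y i) with h | h
        · rw [max_eq_left (by linarith)] at hεi
          rw [max_eq_right (by linarith)]
          nlinarith [mul_nonneg (sub_nonneg.2 hεi) (sub_nonneg.2 hlt')]
        · rw [max_eq_right (by linarith)] at hεi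
          rw [max_eq_left (by linarith), le_antisymm hεi hε0i]
          linarith
    · rw [e1, e2, e3]
      by_cases hb : V i = ⊥
      · rw [hεz i (hyb i (e2.trans hb))]
        simp
      · have hlt' := EReal.toReal_le_toReal hlt hb (hU i)
        nlinarith [mul_nonneg hε0i (sub_nonneg.2 hlt')]
  linarith

end Extension

/-! ### Lattice structure and monotonicity of multiplier sets. -/

section Multipliers

variable {ι : Type*} [Fintype ι] {G : (ι → ℝ) → EReal} {α : ι → ℝ}

theorem IsWelfare.mem_multipliers_iff (hG : IsWelfare G) {A : ι → ℝ} (hA : 0 ≤ A)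
    {τ : ι → EReal} : τ ∈ multipliers G α A ↔ 0 ≤ τ ∧ VanishesAtBot A (reduce α τ) ∧
      ∀ τ', 0 ≤ τ' → VanishesAtBot A (reduce α τ') →
        realPairing A (reduce α τ') - (ext G (reduce α τ')).toReal
          ≤ realPairing A (reduce α τ) - (ext G (reduce α τ)).toReal := by
  have hval : ∀ σ, 0 ≤ σ → VanishesAtBot A (reduce α σ) →
      pairing A (reduce α σ) - ext G (reduce α σ) =
        ((realPairing A (reduce α σ) - (ext G (reduce α σ)).toReal : ℝ) : EReal) := by
    intro σ hσ hb
    rw [hb.pairing_eq (reduce_ne_top hσ), ← hG.coe_ext (reduce_ne_top hσ), ← EReal.coe_sub,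
      EReal.toReal_coe]
  constructor
  · rintro ⟨h0, hne, hmax⟩
    have hb : VanishesAtBot A (reduce α τ) := by
      by_contra hc
      exact hne (by dsimp only; rw [pairing_eq_bot hA hc, EReal.bot_sub])
    refine ⟨h0, hb, fun τ' h0' hb' => ?_⟩
    have h := hmax τ' h0'
    dsimp only at h
    rw [hval τ h0 hb, hval τ' h0' hb'] at h
    exact_mod_cast h
  · rintro ⟨h0, hb, hmax⟩
    refine ⟨h0, ?_, fun τ' h0' => ?_⟩
    · dsimp only
      rw [hval τ h0 hb]
      exact EReal.coe_ne_bot _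
    · dsimp only
      by_cases hb' : VanishesAtBot A (reduce α τ')
      · rw [hval τ h0 hb, hval τ' h0' hb']
        exact_mod_cast hmax τ' h0' hb'
      · rw [pairing_eq_bot hA hb', EReal.bot_sub]
        exact bot_le

/-- Monotone comparative statics: the dual objective is supermodular in the prices, with increasing
differences in the capacity. As `τ ⊔ τ'` cannot beat `τ'` at `A'`, the meet does at least as well as
`τ` at `A`. The case `A' = A` gives closure under meets. -/
theorem IsWelfare.inf_mem_multipliers (hG : IsWelfare G) (hs : IsSubmodular G) {A A' : ι → ℝ}
    (hA' : 0 ≤ A') (hAA' : A' ≤ A) {τ τ' : ι → EReal} (hτ : τ ∈ multipliers G α A)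
    (hτ' : τ' ∈ multipliers G α A') : τ ⊓ τ' ∈ multipliers G α A := by
  have hA : 0 ≤ A := hA'.trans hAA'
  rw [hG.mem_multipliers_iff hA] at hτ ⊢
  rw [hG.mem_multipliers_iff hA'] at hτ'
  obtain ⟨h0, hb, hmax⟩ := hτ
  obtain ⟨h0', hb', hmax'⟩ := hτ'
  have hUt := reduce_ne_top (α := α) h0
  have hVt := reduce_ne_top (α := α) h0'
  have hsub := hG.toReal_ext_inf_add_sup_le hs hUt hVt
  have hbU : ∀ i, A i = 0 → A' i = 0 := fun i h => le_antisymm (h ▸ hAA' i) (hA' i)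
  have hsb : VanishesAtBot A (reduce α (τ ⊓ τ')) := by
    intro i hi
    rw [reduce_inf] at hi
    exact hb i (le_bot_iff.1 (hi ▸ le_sup_left))
  have hib : VanishesAtBot A' (reduce α (τ ⊔ τ')) := by
    intro i hi
    rw [reduce_sup, Pi.inf_apply, min_eq_bot] at hi
    exact hi.elim (fun h => hbU i (hb i h)) (hb' i)
  refine ⟨le_inf h0 h0', hsb, fun σ hσ hσb => (hmax σ hσ hσb).trans ?_⟩
  have h1 := hmax' _ (h0.trans le_sup_left) hib
  have h2 : realPairing A (reduce α τ) + realPairing A' (reduce α τ')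
      ≤ realPairing A (reduce α (τ ⊓ τ')) + realPairing A' (reduce α (τ ⊔ τ')) := by
    rw [reduce_inf, reduce_sup]
    simp only [realPairing]
    rw [← Finset.sum_add_distrib, ← Finset.sum_add_distrib]
    refine Finset.sum_le_sum fun i _ => ?_
    have hAi : A' i ≤ A i := hAA' i
    simp only [Pi.sup_apply, Pi.inf_apply]
    rcases le_total (reduce α τ' i) (reduce α τ i) with h | h
    · rw [sup_eq_left.2 h, inf_eq_right.2 h]
    · rw [sup_eq_right.2 h, inf_eq_left.2 h]
      by_cases hi : reduce α τ i = ⊥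
      · rw [hb i hi, hbU i (hb i hi)]
        simp
      · have := EReal.toReal_le_toReal h hi (hVt i)
        nlinarith [mul_nonneg (sub_nonneg.2 hAi) (sub_nonneg.2 this)]
  rw [reduce_sup] at h1 h2
  rw [reduce_inf] at h2 ⊢
  linarith

theorem lowerSemicontinuousOn_ext_reduce (hG : IsWelfare G) :
    LowerSemicontinuousOn (fun τ => ext G (reduce α τ)) (Set.Ici 0) := by
  refine lowerSemicontinuousOn_iSup fun μ => ?_
  by_cases hμ : μ ∈ dom (conj G)
  · rw [← hG.coe_conj hμ]
    refine ContinuousOn.lowerSemicontinuousOn fun τ hτ => ?_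
    simp only [sub_eq_add_neg]
    exact (EReal.continuousAt_add (p := (pairing μ (reduce α τ), -((conj G μ).toReal : EReal)))
      (Or.inr (by simp [← EReal.coe_neg])) (Or.inr (by simp [← EReal.coe_neg]))).tendsto.comp
      ((continuousOn_pairing_reduce μ (hG.nonneg hμ) τ hτ).prodMk_nhds tendsto_const_nhds)
  · rw [conj_eq_top hμ]
    simp only [EReal.sub_top]
    exact continuousOn_const.lowerSemicontinuousOn

theorem upperSemicontinuousOn_dual (hG : IsWelfare G) {A : ι → ℝ} (hA : 0 ≤ A) :
    UpperSemicontinuousOn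
      (fun τ => pairing A (reduce α τ) - ext G (reduce α τ)) (Set.Ici 0) := by
  have h1 := (continuousOn_pairing_reduce (α := α) A hA).upperSemicontinuousOn
  have h2 : UpperSemicontinuousOn (fun τ => -ext G (reduce α τ)) (Set.Ici 0) :=
    continuous_neg.comp_lowerSemicontinuousOn_antitone
      (lowerSemicontinuousOn_ext_reduce hG) EReal.neg_strictAnti.antitone
  simp only [sub_eq_add_neg]
  refine h1.add' h2 fun τ hτ => EReal.continuousAt_add (Or.inr ?_) (Or.inr ?_)
  all_goals
    rw [← hG.coe_ext (reduce_ne_top hτ), ← EReal.coe_neg]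
    simp

theorem multipliers_nonempty (hG : IsWelfare G) {A : ι → ℝ} (hA : 0 ≤ A) :
    (multipliers G α A).Nonempty := by
  obtain ⟨τ, hτ, hmax⟩ := UpperSemicontinuousOn.exists_isMaxOn (s := Set.Ici (0 : ι → EReal))
    Set.nonempty_Ici isClosed_Ici.isCompact (upperSemicontinuousOn_dual (α := α) hG hA)
  -- The maximum is not `⊥` because the objective is finite at `τ = 0`.
  refine ⟨τ, hτ, fun h => ?_, fun σ hσ => hmax hσ⟩
  have h0 := hmax (Set.mem_Ici.2 (le_refl (0 : ι → EReal)))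
  dsimp only [Set.mem_ofPred_eq] at h0 h
  rw [h, le_bot_iff, ← hG.coe_ext (reduce_ne_top le_rfl), reduce_zero,
    (vanishesAtBot_coe A α).pairing_eq (fun i => EReal.coe_ne_top _), ← EReal.coe_sub] at h0
  exact EReal.coe_ne_bot _ h0

theorem isCompact_multipliers (hG : IsWelfare G) {A : ι → ℝ} (hA : 0 ≤ A) :
    IsCompact (multipliers G α A) := by
  obtain ⟨τ, hτ⟩ := multipliers_nonempty (α := α) hG hA
  have he : multipliers G α A = Set.Ici 0 ∩ (fun σ => pairing A (reduce α σ)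
      - ext G (reduce α σ)) ⁻¹' Set.Ici (pairing A (reduce α τ) - ext G (reduce α τ)) := by
    ext σ
    constructor
    · rintro ⟨h0, _, hmax⟩
      exact ⟨h0, hmax τ hτ.1⟩
    · rintro ⟨h0, hle⟩
      refine ⟨h0, fun h => hτ.2.1 ?_, fun ρ hρ => (hτ.2.2 ρ hρ).trans hle⟩
      dsimp only at h ⊢
      rw [Set.mem_preimage, h] at hle
      exact le_bot_iff.1 hle
  rw [he]
  exact (upperSemicontinuousOn_dual hG hA).isCompact_inter_preimage_Ici isClosed_Ici.isCompact _

/-- By compactness each coordinate is minimized by some multiplier; the meet of these finitely many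
minimizers is again a multiplier. -/
theorem isLeast_leastMultiplier (hG : IsWelfare G) (hs : IsSubmodular G) {A : ι → ℝ}
    (hA : 0 ≤ A) : IsLeast (multipliers G α A) (leastMultiplier G α A) := by
  classical
  obtain ⟨τ₀, hτ₀⟩ := multipliers_nonempty (α := α) hG hA
  have hcomp := isCompact_multipliers (α := α) hG hA
  have hmin : ∀ i, ∃ σ ∈ multipliers G α A, ∀ ρ ∈ multipliers G α A, σ i ≤ ρ i := fun i => by
    obtain ⟨σ, hσ, h⟩ := hcomp.exists_isMinOn ⟨τ₀, hτ₀⟩ (continuous_apply i).continuousOn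
    exact ⟨σ, hσ, fun ρ hρ => h hρ⟩
  choose σ hσ hσmin using hmin
  have hfin : ∀ s : Finset ι, ∃ ρ ∈ multipliers G α A, ∀ i ∈ s, ρ i ≤ σ i i := by
    intro s
    induction s using Finset.induction_on with
    | empty => exact ⟨τ₀, hτ₀, by simp⟩
    | insert j s _ ih =>
      obtain ⟨ρ, hρ, hle⟩ := ih
      refine ⟨ρ ⊓ σ j, hG.inf_mem_multipliers hs hA le_rfl hρ (hσ j), fun i hi => ?_⟩
      rcases Finset.mem_insert.1 hi with rfl | hi
      · exact inf_le_right
      · exact (inf_le_left (a := ρ i)).trans (hle i hi)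
  obtain ⟨ρ, hρ, hle⟩ := hfin Finset.univ
  have hl : IsLeast (multipliers G α A) ρ :=
    ⟨hρ, fun τ hτ i => (hle i (Finset.mem_univ i)).trans (hσmin i τ hτ)⟩
  rw [leastMultiplier, hl.isGLB.sInf_eq]
  exact hl

theorem leastMultiplier_antitone (hG : IsWelfare G) (hs : IsSubmodular G) {A A' : ι → ℝ}
    (hA' : 0 ≤ A') (hAA' : A' ≤ A) : leastMultiplier G α A ≤ leastMultiplier G α A' :=
  ((isLeast_leastMultiplier hG hs (hA'.trans hAA')).2 (hG.inf_mem_multipliers hs hA' hAA'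
    (isLeast_leastMultiplier hG hs (hA'.trans hAA')).1
    (isLeast_leastMultiplier hG hs hA').1)).trans inf_le_right

end Multipliers

/-! ### Constrained maximizers and re-choosing retained amounts. -/

section Argmax

variable {ι : Type*} [Fintype ι] {G : (ι → ℝ) → EReal} {α : ι → ℝ}

theorem IsWelfare.mem_argmaxOn_objective_iff (hG : IsWelfare G) {S : Set (ι → ℝ)} {x : ι → ℝ} :
    x ∈ argmaxOn S (objective G α) ↔ x ∈ dom (conj G) ∩ S ∧ ∀ ν ∈ dom (conj G) ∩ S,
      ∑ i, ν i * α i - (conj G ν).toReal ≤ ∑ i, x i * α i - (conj G x).toReal := by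
  have hval : ∀ ν ∈ dom (conj G),
      objective G α ν = ((∑ i, ν i * α i - (conj G ν).toReal : ℝ) : EReal) := by
    intro ν hν
    rw [objective, ← hG.coe_conj hν, ← EReal.coe_sub, EReal.toReal_coe]
  have hbot : ∀ ν, ν ∉ dom (conj G) → objective G α ν = ⊥ := by
    intro ν hν
    rw [objective, conj_eq_top hν, EReal.sub_top]
  constructor
  · rintro ⟨hS, hne, hmax⟩
    have hx : x ∈ dom (conj G) := by
      by_contra h
      exact hne (hbot x h)
    refine ⟨⟨hx, hS⟩, fun ν hν => ?_⟩
    have h := hmax ν hν.2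
    rw [hval ν hν.1, hval x hx] at h
    exact_mod_cast h
  · rintro ⟨⟨hx, hS⟩, hmax⟩
    refine ⟨hS, by rw [hval x hx]; exact EReal.coe_ne_bot _, fun ν hν => ?_⟩
    by_cases h : ν ∈ dom (conj G)
    · rw [hval ν h, hval x hx]
      exact_mod_cast hmax ν ⟨h, hν⟩
    · rw [hbot ν h]
      exact bot_le

theorem IsWelfare.disposals_nonempty (hG : IsWelfare G) {A : ι → ℝ} (hA : 0 ≤ A) :
    (disposals G α A).Nonempty := by
  obtain ⟨μ, hμ, hmax⟩ := hG.exists_isMax α (S := Set.Iic A) isClosed_Iic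
    ⟨0, hG.isLeast_zero.1, hA⟩
  exact ⟨μ, hG.mem_argmaxOn_objective_iff.2 ⟨hμ, hmax⟩⟩

theorem mem_proposals_of_mem_disposals {A T Q : ι → ℝ} (hQ : Q ∈ disposals G α A) (hT : T ≤ Q) :
    Q ∈ proposals G α T A :=
  ⟨⟨hT, hQ.1⟩, hQ.2.1, fun ν hν => hQ.2.2 ν hν.2⟩

/-- `disposals G α A` serves as the proposer's problem without lower bound. One of its solutions
already lies above `T`, so imposing `T` does not lower the maximum. -/
theorem mem_disposals_of_mem_proposals {A T P Q : ι → ℝ} (hQ : Q ∈ disposals G α A) (hT : T ≤ Q)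
    (hP : P ∈ proposals G α T A) : P ∈ disposals G α A :=
  ⟨hP.1.2, hP.2.1, fun ν hν => (hQ.2.2 ν hν).trans (hP.2.2 Q ⟨hT, hQ.1⟩)⟩

/-- Choices from `A` that remain available in `A' ≤ A` can be chosen again from `A'`. -/
theorem IsWelfare.exists_disposal_ge (hG : IsWelfare G) (hs : IsSubmodular G)
    {A A' P T : ι → ℝ} (hP : P ∈ disposals G α A) (hT0 : 0 ≤ T) (hTP : T ≤ P) (hTA' : T ≤ A')
    (hA' : A' ≤ A) : ∃ Q ∈ disposals G α A', T ≤ Q := by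
  obtain ⟨Q, hQ⟩ := hG.disposals_nonempty (α := α) (hT0.trans hTA')
  obtain ⟨⟨hPd, hPA⟩, hPmax⟩ := hG.mem_argmaxOn_objective_iff.1 hP
  obtain ⟨⟨hQd, hQA⟩, hQmax⟩ := hG.mem_argmaxOn_objective_iff.1 hQ
  -- The exchange lifts `Q` up to `T` where it falls short; `T ≤ P` makes this `δ` admissible. The
  -- altered `P` stays below `A` and cannot improve on `P`, so the altered `Q` is no worse than `Q`.
  obtain ⟨ε, hε0, hε, hxd, hyd, hle⟩ := exists_exchange hG.convex hG.proper hG.lsc hs hPd hQd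
    (δ := fun i => max (T i - Q i) 0) (fun i => le_max_right _ _)
    (fun i => max_le_max (sub_le_sub_right (hTP i) _) le_rfl)
  set δ : ι → ℝ := fun i => max (T i - Q i) 0 with hδ
  have hcase : ∀ i, (Q i ≤ T i ∧ δ i = T i - Q i ∧ ε i = 0) ∨
      (T i ≤ Q i ∧ δ i = 0 ∧ ε i ≤ max (Q i - P i) 0) := by
    intro i
    rcases le_total (Q i) (T i) with h | h
    · refine Or.inl ⟨h, max_eq_left (by linarith), le_antisymm ?_ (hε0 i)⟩
      have h1 := hε i
      have h2 : T i ≤ P i := hTP i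
      rwa [max_eq_right (by linarith)] at h1
    · exact Or.inr ⟨h, max_eq_right (by linarith), hε i⟩
  have hx : P - δ + ε ≤ A := by
    intro i
    have h1 : P i ≤ A i := hPA i
    have h2 : Q i ≤ A' i := hQA i
    have h3 : A' i ≤ A i := hA' i
    simp only [Pi.add_apply, Pi.sub_apply]
    rcases hcase i with ⟨h, e1, e2⟩ | ⟨h, e1, e2⟩
    · rw [e1, e2]
      linarith
    · rw [e1]
      rcases le_total (Q i) (P i) with h' | h'
      · rw [max_eq_right (by linarith)] at e2
        linarith
      · rw [max_eq_left (by linarith)] at e2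
        linarith
  have hy : Q + δ - ε ≤ A' := by
    intro i
    have h1 : T i ≤ A' i := hTA' i
    have h2 : Q i ≤ A' i := hQA i
    have h3 := hε0 i
    simp only [Pi.add_apply, Pi.sub_apply]
    rcases hcase i with ⟨h, e1, e2⟩ | ⟨h, e1, e2⟩ <;> rw [e1] <;> linarith
  have hTy : T ≤ Q + δ - ε := by
    intro i
    have h1 : T i ≤ P i := hTP i
    simp only [Pi.add_apply, Pi.sub_apply]
    rcases hcase i with ⟨h, e1, e2⟩ | ⟨h, e1, e2⟩
    · rw [e1, e2]
      linarith
    · rw [e1]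
      rcases le_total (Q i) (P i) with h' | h'
      · rw [max_eq_right (by linarith)] at e2
        linarith
      · rw [max_eq_left (by linarith)] at e2
        linarith
  refine ⟨Q + δ - ε, hG.mem_argmaxOn_objective_iff.2 ⟨⟨hyd, hy⟩, fun ν hν =>
    (hQmax ν hν).trans ?_⟩, hTy⟩
  have h1 := hPmax _ ⟨hxd, hx⟩
  have h2 : ∑ i, (P - δ + ε) i * α i + ∑ i, (Q + δ - ε) i * α i
      = ∑ i, P i * α i + ∑ i, Q i * α i := by
    rw [← Finset.sum_add_distrib, ← Finset.sum_add_distrib]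
    exact Finset.sum_congr rfl fun i _ => by simp only [Pi.add_apply, Pi.sub_apply]; ring
  linarith

end Argmax

/-! ### Lagrangian duality and stability of the subdifferential. -/

section Duality

variable {ι : Type*} [Fintype ι] {G : (ι → ℝ) → EReal} {α : ι → ℝ}

/-- Minimax for the Lagrangian `F μ s`: for fixed `s`, a vector attaining `ext G` at `α - s` meets
the level. Real multipliers suffice: large ones enforce `μ ≤ A` and `s = 0` gives the value. -/
theorem IsWelfare.exists_primal_ge (hG : IsWelfare G) {A : ι → ℝ} {c : ℝ}
    (hc : ∀ s : ι → ℝ, 0 ≤ s → ∑ i, A i * (α i - s i)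
      - (ext G (reduce α fun i => (s i : EReal))).toReal ≤ c) :
    ∃ μ ∈ dom (conj G), μ ≤ A ∧
      ∑ i, A i * α i - c ≤ ∑ i, μ i * α i - (conj G μ).toReal := by
  classical
  let F : (ι → ℝ) → (ι → ℝ) → ℝ := fun μ s =>
    (conj G μ).toReal + (-∑ i, μ i * α i + ∑ i, s i * (μ i - A i))
  have key : ∃ μ ∈ dom (conj G), ∀ s ∈ Set.Ici (0 : ι → ℝ), F μ s ≤ c - ∑ i, A i * α i := by
    refine exists_forall_le_of_forall_exists_le ⟨0, hG.isLeast_zero.1⟩ hG.compact_dom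
      hG.convexOn_conj.1 (convex_Ici 0) ?_ ?_ ?_ ?_ ?_
    · exact fun s _ => hG.lsc_conj.add
        ((Continuous.lowerSemicontinuous (by fun_prop)).lowerSemicontinuousOn _)
    · intro s _
      refine hG.convexOn_conj.add ⟨hG.convexOn_conj.1, fun a _ b _ p q _ _ hpq => le_of_eq ?_⟩
      have hr : q = 1 - p := by linarith
      simp only [smul_eq_mul, hr, Pi.add_apply, Pi.smul_apply]
      rw [mul_add, mul_add, mul_neg, mul_neg, Finset.mul_sum, Finset.mul_sum, Finset.mul_sum,
        Finset.mul_sum, ← Finset.sum_neg_distrib, ← Finset.sum_neg_distrib,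
        ← Finset.sum_neg_distrib, ← Finset.sum_add_distrib, ← Finset.sum_add_distrib,
        ← Finset.sum_add_distrib, ← Finset.sum_add_distrib]
      exact Finset.sum_congr rfl fun i _ => by ring
    · exact fun μ _ => (show Continuous fun s => F μ s by
        fun_prop).upperSemicontinuous.upperSemicontinuousOn _
    · intro μ _
      refine ⟨convex_Ici 0, fun a _ b _ p q _ _ hpq => le_of_eq ?_⟩
      have hr : q = 1 - p := by linarith
      have e : ∑ i, (p • a + q • b) i * (μ i - A i)
          = p * ∑ i, a i * (μ i - A i) + q * ∑ i, b i * (μ i - A i) := by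
        rw [Finset.mul_sum, Finset.mul_sum, ← Finset.sum_add_distrib]
        exact Finset.sum_congr rfl fun i _ => by
          simp only [smul_eq_mul, Pi.add_apply, Pi.smul_apply]; ring
      simp only [F]
      rw [e]
      simp only [smul_eq_mul, hr]
      ring
    · intro s hs
      have hs' : (0 : ι → EReal) ≤ fun i => (s i : EReal) :=
        fun i => EReal.coe_nonneg.2 (hs i)
      obtain ⟨μ, hμ, _, he⟩ := hG.exists_toReal_ext_eq (reduce_ne_top (α := α) hs')
      refine ⟨μ, hμ, ?_⟩
      have h := hc s hs
      have e : realPairing μ (reduce α fun i => (s i : EReal)) = ∑ i, μ i * (α i - s i) := by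
        refine Finset.sum_congr rfl fun i _ => ?_
        rw [toReal_reduce hs' (EReal.coe_ne_top _), EReal.toReal_coe]
      rw [he, e] at h
      simp only [mul_sub, Finset.sum_sub_distrib] at h
      simp only [F, mul_sub, Finset.sum_sub_distrib]
      simp only [mul_comm (s _)]
      linarith
  obtain ⟨μ, hμ, hF⟩ := key
  refine ⟨μ, hμ, fun i => ?_, ?_⟩
  · by_contra hlt
    rw [not_le] at hlt
    have hd : 0 < μ i - A i := by linarith
    -- `b` is all the penalty the bound permits; the multiplier below produces the penalty `|b| + (μ
    -- i - A i) > b`.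
    set b := c - ∑ i, A i * α i - ((conj G μ).toReal + -∑ i, μ i * α i) with hb
    have hK : 0 ≤ |b| / (μ i - A i) + 1 := by positivity
    have h := hF (Pi.single i (|b| / (μ i - A i) + 1)) (Pi.single_nonneg.2 hK)
    have e : ∑ j, (Pi.single i (|b| / (μ i - A i) + 1) : ι → ℝ) j * (μ j - A j)
        = |b| + (μ i - A i) := by
      rw [Finset.sum_eq_single i]
      · rw [Pi.single_eq_same]
        field_simp
      · intro j _ hj
        rw [Pi.single_eq_of_ne hj, zero_mul]
      · simp
    simp only [F] at h
    rw [e] at h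
    linarith [le_abs_self b]
  · have h := hF 0 (Set.mem_Ici.2 le_rfl)
    simp only [F, Pi.zero_apply, zero_mul, Finset.sum_const_zero] at h
    linarith

/-- Strong duality: a constrained maximizer is optimal at multiplier-adjusted prices, and
complementary slackness holds. -/
theorem IsWelfare.mem_subdiff_of_mem_multipliers (hG : IsWelfare G) {A P : ι → ℝ} (hA : 0 ≤ A)
    {τ : ι → EReal} (hP : P ∈ disposals G α A) (hτ : τ ∈ multipliers G α A) :
    P ∈ subdiff G (reduce α τ) ∧ ∀ i, 0 < τ i → P i = A i := by
  obtain ⟨h0, hb, hmax⟩ := (hG.mem_multipliers_iff hA).1 hτ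
  obtain ⟨⟨hPd, hPA⟩, hPmax⟩ := hG.mem_argmaxOn_objective_iff.1 hP
  have hP0 := hG.nonneg hPd
  have hUt := reduce_ne_top (α := α) h0
  obtain ⟨μ, hμ, hμA, hμc⟩ := hG.exists_primal_ge (A := A) (α := α)
    (c := realPairing A (reduce α τ) - (ext G (reduce α τ)).toReal) (fun s hs => by
      have hs' : (0 : ι → EReal) ≤ fun i => (s i : EReal) :=
        fun i => EReal.coe_nonneg.2 (hs i)
      have h := hmax (fun i => (s i : EReal)) hs' fun i hi =>
        absurd ((reduce_eq_bot_iff i).1 hi) (EReal.coe_ne_top _)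
      have e : realPairing A (reduce α fun i => (s i : EReal)) = ∑ i, A i * (α i - s i) := by
        refine Finset.sum_congr rfl fun i _ => ?_
        rw [toReal_reduce hs' (EReal.coe_ne_top _), EReal.toReal_coe]
      rwa [e] at h)
  have hPb : VanishesAtBot P (reduce α τ) := fun i hi =>
    le_antisymm ((hPA i).trans (hb i hi).le) (hP0 i)
  have h1 := hPmax μ ⟨hμ, hμA⟩
  have hterm : ∀ i, (A i - P i) * (τ i).toReal
      = A i * α i - A i * (reduce α τ i).toReal
        - (P i * α i - P i * (reduce α τ i).toReal) := by
    intro i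
    by_cases hi : τ i = ⊤
    · have hi' := (reduce_eq_bot_iff (α := α) i).2 hi
      rw [hb i hi', hPb i hi']
      simp
    · rw [toReal_reduce h0 hi]
      ring
  have hsum : ∑ i, (A i - P i) * (τ i).toReal = ∑ i, A i * α i - realPairing A (reduce α τ)
      - (∑ i, P i * α i - realPairing P (reduce α τ)) := by
    simp only [realPairing, ← Finset.sum_sub_distrib]
    exact Finset.sum_congr rfl fun i _ => hterm i
  have hnn : ∀ i ∈ Finset.univ, 0 ≤ (A i - P i) * (τ i).toReal := fun i _ =>
    mul_nonneg (sub_nonneg.2 (hPA i)) (EReal.toReal_nonneg (h0 i))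
  -- This sum is the complementary slackness gap. Strong duality gives gap `+ G*(P) + G(α - τ) ≤ P ·
  -- (α - τ)`: nonnegativity yields the subgradient relation, and Fenchel's inequality forces the
  -- gap to be `0`.
  have hnn' := Finset.sum_nonneg hnn
  refine ⟨(hG.mem_subdiff_iff hUt).2 ⟨hPd, hPb, by linarith⟩, fun i hi => ?_⟩
  have h2 := hG.le_toReal_ext hUt hPd hPb
  have h3 := (Finset.sum_eq_zero_iff_of_nonneg hnn).1 (by linarith) i (Finset.mem_univ i)
  by_cases ht : τ i = ⊤
  · have hi' := (reduce_eq_bot_iff (α := α) i).2 ht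
    rw [hb i hi', hPb i hi']
  · have hpos := EReal.toReal_pos hi ht
    rcases mul_eq_zero.1 h3 with h | h
    · linarith
    · exact absurd h hpos.ne'

theorem IsWelfare.mem_multipliers_of_mem_subdiff (hG : IsWelfare G) {P : ι → ℝ} {τ : ι → EReal}
    (h0 : 0 ≤ τ) (hP : P ∈ subdiff G (reduce α τ)) : τ ∈ multipliers G α P := by
  obtain ⟨hPd, hPb, hle⟩ := (hG.mem_subdiff_iff (reduce_ne_top h0)).1 hP
  refine (hG.mem_multipliers_iff (hG.nonneg hPd)).2 ⟨h0, hPb, fun τ' h0' hb' => ?_⟩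
  have := hG.le_toReal_ext (reduce_ne_top h0') hPd hb'
  linarith

/-- The graph of the subdifferential is closed. -/
theorem IsWelfare.mem_subdiff_of_tendsto (hG : IsWelfare G) {m : ℕ → ι → ℝ} {t : ℕ → ι → EReal}
    {μ : ι → ℝ} {τ : ι → EReal} (ht0 : ∀ j, 0 ≤ t j) (hm : ∀ j, m j ∈ subdiff G (reduce α (t j)))
    (hmμ : Tendsto m atTop (𝓝 μ)) (htτ : Tendsto t atTop (𝓝 τ)) :
    μ ∈ subdiff G (reduce α τ) := by
  have hτ0 : 0 ≤ τ := ge_of_tendsto' htτ ht0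
  have hUt := reduce_ne_top (α := α) hτ0
  have hμd : μ ∈ dom (conj G) :=
    hG.compact_dom.isClosed.mem_of_tendsto hmμ (Eventually.of_forall fun j => (hm j).1)
  have hμ0 := hG.nonneg hμd
  have hm0 : ∀ j, 0 ≤ m j := fun j => hG.nonneg (hm j).1
  -- Where `μ i = 0` the products may have the form `0 · (-∞)` in the limit and need not converge.
  -- They are replaced by the upper bound `m j i * α i`, which tends to `0`; only an inequality is
  -- needed in the limit.
  let b : ι → ℕ → EReal := fun i j =>
    if μ i = 0 then ((m j i * α i : ℝ) : EReal) else (m j i : EReal) * reduce α (t j) i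
  have hb : ∀ i ∈ Finset.univ, Tendsto (b i) atTop (𝓝 ((μ i : EReal) * reduce α τ i)) := by
    intro i _
    have hmi : Tendsto (fun j => m j i) atTop (𝓝 (μ i)) := (tendsto_pi_nhds.1 hmμ) i
    by_cases hi : μ i = 0
    · simp only [b, hi, if_true, EReal.coe_zero, zero_mul]
      have h := hmi.mul_const (α i)
      rw [hi, zero_mul] at h
      simpa using EReal.tendsto_coe.2 h
    · simp only [b, hi, if_false]
      have hUi : Tendsto (fun j => reduce α (t j) i) atTop (𝓝 (reduce α τ i)) :=
        tendsto_pi_nhds.1 ((continuous_reduce.tendsto τ).comp htτ) i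
      exact EReal.Tendsto.mul (EReal.tendsto_coe.2 hmi) hUi
        (Or.inl (by exact_mod_cast hi)) (Or.inl (by exact_mod_cast hi))
        (Or.inl (EReal.coe_ne_bot _)) (Or.inl (EReal.coe_ne_top _))
  have hbt : ∀ i ∈ Finset.univ, (μ i : EReal) * reduce α τ i ≠ ⊤ := by
    intro i _ h
    rcases (EReal.mul_eq_top _ _).1 h with h | h | h | h
    · exact EReal.coe_ne_bot _ h.1
    · exact absurd h.1 (not_lt.2 (EReal.coe_nonneg.2 (hμ0 i)))
    · exact EReal.coe_ne_top _ h.1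
    · exact hUt i h.2
  have hlim := (tendsto_finset_sum_ereal Finset.univ hb hbt).1
  have hle : ∀ j, pairing (m j) (reduce α (t j)) ≤ ∑ i, b i j := by
    intro j
    refine Finset.sum_le_sum fun i _ => ?_
    dsimp only [b]
    split_ifs with hi
    · rw [EReal.coe_mul]
      refine mul_le_mul_of_nonneg_left ?_ (EReal.coe_nonneg.2 (hm0 j i))
      have : (α i : EReal) - t j i ≤ α i - 0 := EReal.sub_le_sub le_rfl (ht0 j i)
      rwa [sub_zero] at this
    · exact le_rfl
  have hfin : conj G μ + ext G (reduce α τ) ≤ pairing μ (reduce α τ) := by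
    refine EReal.add_le_of_forall_lt fun c hc d hd => ge_of_tendsto hlim ?_
    have h1 := hmμ.eventually (lowerSemicontinuous_conj μ c hc)
    have h2 := (tendsto_nhdsWithin_iff.2 ⟨htτ, Eventually.of_forall fun j =>
      Set.mem_Ici.2 (ht0 j)⟩).eventually (lowerSemicontinuousOn_ext_reduce hG τ hτ0 d hd)
    filter_upwards [h1, h2] with j hj1 hj2
    calc c + d ≤ conj G (m j) + ext G (reduce α (t j)) := add_le_add hj1.le hj2.le
      _ = pairing (m j) (reduce α (t j)) := (hm j).2
      _ ≤ _ := hle j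
  rw [← hG.coe_conj hμd, ← hG.coe_ext hUt, ← EReal.coe_add] at hfin
  have hμb : VanishesAtBot μ (reduce α τ) := by
    by_contra h
    rw [pairing_eq_bot hμ0 h, le_bot_iff] at hfin
    exact EReal.coe_ne_bot _ hfin
  rw [hμb.pairing_eq hUt] at hfin
  exact (hG.mem_subdiff_iff hUt).2 ⟨hμd, hμb, by exact_mod_cast hfin⟩

/-- Multipliers may be dropped where `μ` attains an upper bound of `dom G*`. -/
theorem IsWelfare.mem_subdiff_indicator (hG : IsWelfare G) {n μ : ι → ℝ} {τ : ι → EReal}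
    (hn : n ∈ upperBounds (dom (conj G))) (h0 : 0 ≤ τ) (hμ : μ ∈ subdiff G (reduce α τ)) :
    μ ∈ subdiff G (reduce α ({i | μ i < n i}.indicator τ)) := by
  classical
  set σ := {i | μ i < n i}.indicator τ with hσ
  have hσ1 : ∀ i, μ i < n i → σ i = τ i := fun i hi => Set.indicator_of_mem (by exact hi) τ
  have hσ2 : ∀ i, ¬ μ i < n i → σ i = 0 := fun i hi => Set.indicator_of_notMem (by exact hi) τ
  have hσ0 : 0 ≤ σ := fun i => Set.indicator_apply_nonneg fun _ => h0 i
  obtain ⟨hμd, hμb, hle⟩ := (hG.mem_subdiff_iff (reduce_ne_top h0)).1 hμ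
  obtain ⟨ν, hν, hνb, hνe⟩ := hG.exists_toReal_ext_eq (reduce_ne_top (α := α) hσ0)
  have hν0 := hG.nonneg hν
  have hσt : ∀ i, σ i = ⊤ → τ i = ⊤ := by
    intro i hi
    by_cases h : μ i < n i
    · rwa [hσ1 i h] at hi
    · rw [hσ2 i h] at hi
      exact absurd hi EReal.zero_ne_top
  have hνb' : VanishesAtBot ν (reduce α τ) := by
    intro i hi
    by_cases h : μ i < n i
    · refine hνb i ?_
      rw [reduce_eq_bot_iff] at hi ⊢
      rw [hσ1 i h, hi]
    -- Here `τ i = ⊤` forces `μ i = 0`, hence `n i ≤ 0`, and `ν i ≤ n i`.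
    · refine le_antisymm ?_ (hν0 i)
      have h1 : ν i ≤ n i := hn hν i
      have h2 := hμb i hi
      linarith
  refine (hG.mem_subdiff_iff (reduce_ne_top hσ0)).2 ⟨hμd, fun i hi => hμb i ?_, ?_⟩
  · rw [reduce_eq_bot_iff] at hi ⊢
    exact hσt i hi
  · have h1 := hG.le_toReal_ext (reduce_ne_top h0) hν hνb'
    -- Prices rise only where `n i ≤ μ i`, hence `ν i ≤ μ i`, so `μ` gains at least as much as the
    -- competitor `ν`.
    have h2 : realPairing ν (reduce α σ) + realPairing μ (reduce α τ)
        ≤ realPairing μ (reduce α σ) + realPairing ν (reduce α τ) := by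
      simp only [realPairing]
      rw [← Finset.sum_add_distrib, ← Finset.sum_add_distrib]
      refine Finset.sum_le_sum fun i _ => ?_
      by_cases h : μ i < n i
      · have e : reduce α σ i = reduce α τ i := by simp only [reduce, hσ1 i h]
        rw [e]
        linarith
      · by_cases ht : τ i = ⊤
        · rw [hμb i ((reduce_eq_bot_iff i).2 ht), hνb' i ((reduce_eq_bot_iff i).2 ht)]
        · have hst : σ i ≠ ⊤ := fun h => ht (hσt i h)
          rw [toReal_reduce hσ0 hst, toReal_reduce h0 ht, hσ2 i h, EReal.toReal_zero]
          have h3 : ν i ≤ n i := hn hν i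
          have h4 := EReal.toReal_nonneg (h0 i)
          have h5 : ν i ≤ μ i := by linarith
          nlinarith [mul_nonneg (sub_nonneg.2 h5) h4]
    linarith

end Duality

/-! ### Runs of the algorithm and their limits. -/

section Algorithm

variable {ι : Type*} [Fintype ι] {G H : (ι → ℝ) → EReal} {α γ nG nH : ι → ℝ}

/-- The last clause carries the induction: after a round, `T' ≤ P` was part of an optimal choice
from `A` and is still available, so it can be chosen again. -/
theorem Reachable.invariant (hG : IsWelfare G) (hGs : IsSubmodular G) (hH : IsWelfare H)
    (hnG : nG ∈ upperBounds (dom (conj G))) (hnH : nH ∈ upperBounds (dom (conj H)))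
    {A T : ι → ℝ} (h : Reachable G H α γ nG nH A T) :
    0 ≤ T ∧ T ≤ A ∧ ∃ Q ∈ disposals G α A, T ≤ Q := by
  induction h with
  | init =>
    have h0 : 0 ≤ nG ⊓ nH := le_inf (hnG hG.isLeast_zero.1) (hnH hH.isLeast_zero.1)
    obtain ⟨Q, hQ⟩ := hG.disposals_nonempty (α := α) h0
    exact ⟨le_rfl, h0, Q, hQ, hG.nonneg (hG.mem_argmaxOn_objective_iff.1 hQ).1.1⟩
  | @round A T P T' _ hP hT' ih =>
    obtain ⟨_, _, Q, hQ, hTQ⟩ := ih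
    have hPd := mem_disposals_of_mem_proposals hQ hTQ hP
    have hT'0 := hH.nonneg (hH.mem_argmaxOn_objective_iff.1 hT').1.1
    have hT'A : T' ≤ A - (P - T') := fun i => by
      have h1 : P i ≤ A i := hPd.1 i
      simp only [Pi.sub_apply]
      linarith
    have hA : A - (P - T') ≤ A := fun i => by
      have h1 : T' i ≤ P i := hT'.1 i
      simp only [Pi.sub_apply]
      linarith
    exact ⟨hT'0, hT'A, hG.exists_disposal_ge hGs hPd hT'0 hT'.1 hT'A hA⟩

theorem exists_isRun (hG : IsWelfare G) (hGs : IsSubmodular G) (hH : IsWelfare H)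
    (hnG : nG ∈ upperBounds (dom (conj G))) (hnH : nH ∈ upperBounds (dom (conj H))) :
    ∃ μA μP μT : ℕ → ι → ℝ, IsRun G H α γ nG nH μA μP μT := by
  have hstep : ∀ s : {p : (ι → ℝ) × (ι → ℝ) // Reachable G H α γ nG nH p.1 p.2},
      ∃ P T', P ∈ proposals G α s.1.2 s.1.1 ∧ T' ∈ disposals H γ P := by
    rintro ⟨⟨A, T⟩, hr⟩
    obtain ⟨_, _, Q, hQ, hTQ⟩ := hr.invariant hG hGs hH hnG hnH
    obtain ⟨T', hT'⟩ := hH.disposals_nonempty (α := γ)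
      (hG.nonneg (hG.mem_argmaxOn_objective_iff.1 hQ).1.1)
    exact ⟨Q, T', mem_proposals_of_mem_disposals hQ hTQ, hT'⟩
  choose P T' hP hT' using hstep
  let next : {p : (ι → ℝ) × (ι → ℝ) // Reachable G H α γ nG nH p.1 p.2} →
      {p : (ι → ℝ) × (ι → ℝ) // Reachable G H α γ nG nH p.1 p.2} := fun s =>
    ⟨(s.1.1 - (P s - T' s), T' s), s.2.round (hP s) (hT' s)⟩
  let st : ℕ → {p : (ι → ℝ) × (ι → ℝ) // Reachable G H α γ nG nH p.1 p.2} := fun k =>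
    Nat.rec ⟨(nG ⊓ nH, 0), Reachable.init⟩ (fun _ s => next s) k
  have hdel : ∀ k, delayed (fun k => T' (st k)) k = (st k).1.2 := by
    rintro (_ | k) <;> rfl
  refine ⟨fun k => (st k).1.1, fun k => P (st k), fun k => T' (st k), rfl, fun k => ?_,
    fun k => hT' (st k), fun k => rfl⟩
  rw [hdel]
  exact hP (st k)

variable {μA μP μT : ℕ → ι → ℝ}

theorem IsRun.reachable (hr : IsRun G H α γ nG nH μA μP μT) (k : ℕ) :
    Reachable G H α γ nG nH (μA k) (delayed μT k) := by
  induction k with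
  | zero => exact hr.init ▸ Reachable.init
  | succ k ih => exact hr.update k ▸ ih.round (hr.proposal k) (hr.disposal k)

theorem IsRun.exists_convergent (hG : IsWelfare G) (hr : IsRun G H α γ nG nH μA μP μT) :
    ∃ φ : ℕ → ℕ, StrictMono φ ∧ ∃ (μ : ι → ℝ) (τP τT : ι → EReal),
      Tendsto (fun j => μP (φ j)) atTop (𝓝 μ) ∧
      Tendsto (fun j => leastMultiplier G α (μA (φ j))) atTop (𝓝 τP) ∧
      Tendsto (fun j => leastMultiplier H γ (μP (φ j))) atTop (𝓝 τT) := by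
  have hc : IsCompact (dom (conj G) ×ˢ (Set.univ : Set ((ι → EReal) × (ι → EReal)))) :=
    hG.compact_dom.prod isCompact_univ
  obtain ⟨⟨μ, τP, τT⟩, _, φ, hφ, hlim⟩ := hc.tendsto_subseq
    (x := fun k => (μP k, leastMultiplier G α (μA k), leastMultiplier H γ (μP k)))
    fun k => ⟨(hG.mem_argmaxOn_objective_iff.1 (hr.proposal k)).1.1, trivial⟩
  rw [nhds_prod_eq, nhds_prod_eq] at hlim
  exact ⟨φ, hφ, μ, τP, τT, hlim.fst, hlim.snd.fst, hlim.snd.snd⟩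

/-- The rejections are the decrements of `μA`, which decreases and is bounded below. -/
theorem IsRun.tendsto_sub_zero (hr : IsRun G H α γ nG nH μA μP μT) (hA0 : ∀ k, 0 ≤ μA k)
    (hA : Antitone μA) : Tendsto (fun k => μP k - μT k) atTop (𝓝 0) := by
  rw [tendsto_pi_nhds]
  intro i
  have hconv := tendsto_atTop_ciInf (f := fun k => μA k i) (fun a b hab => hA hab i)
    ⟨0, by rintro _ ⟨k, rfl⟩; exact hA0 k i⟩
  have h := hconv.sub (hconv.comp (tendsto_add_atTop_nat 1))
  rw [sub_self] at h
  refine h.congr fun k => ?_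
  simp only [Function.comp_apply, hr.update k, Pi.sub_apply]
  ring

theorem coe_sub_sub_self (a : ℝ) (t : EReal) : (a : EReal) - t - a = -t := by
  induction t with
  | bot => simp
  | top => simp
  | coe t =>
    norm_cast
    ring

theorem IsRun.isGenEquilibrium (hG : IsWelfare G) (hGs : IsSubmodular G) (hH : IsWelfare H)
    (hHs : IsSubmodular H) (hnG : nG ∈ upperBounds (dom (conj G)))
    (hnH : nH ∈ upperBounds (dom (conj H))) (hr : IsRun G H α γ nG nH μA μP μT)
    {φ : ℕ → ℕ} (hφ : StrictMono φ) {μ : ι → ℝ} {τP τT : ι → EReal}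
    (hμ : Tendsto (fun j => μP (φ j)) atTop (𝓝 μ))
    (hτP : Tendsto (fun j => leastMultiplier G α (μA (φ j))) atTop (𝓝 τP))
    (hτT : Tendsto (fun j => leastMultiplier H γ (μP (φ j))) atTop (𝓝 τT)) :
    IsGenEquilibrium G H α γ μ (reduce α ({i | μ i < nG i}.indicator τP))
      (reduce γ ({i | μ i < nH i}.indicator τT)) := by
  classical
  have inv := fun k => (hr.reachable k).invariant hG hGs hH hnG hnH
  have hA0 : ∀ k, 0 ≤ μA k := fun k => (inv k).1.trans (inv k).2.1
  have hPdis : ∀ k, μP k ∈ disposals G α (μA k) := fun k => by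
    obtain ⟨_, _, Q, hQ, hTQ⟩ := inv k
    exact mem_disposals_of_mem_proposals hQ hTQ (hr.proposal k)
  have hP0 : ∀ k, 0 ≤ μP k := fun k =>
    hG.nonneg (hG.mem_argmaxOn_objective_iff.1 (hPdis k)).1.1
  have hTP : ∀ k, μT k ≤ μP k := fun k => (hr.disposal k).1
  have hTP' : ∀ k, μT k ≤ μP (k + 1) := fun k => (hr.proposal (k + 1)).1.1
  have hT0 : ∀ k, 0 ≤ μT k := fun k => (inv (k + 1)).1
  have hA : Antitone μA := antitone_nat_of_succ_le fun k => by
    rw [hr.update k]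
    exact sub_le_self _ (sub_nonneg.2 (hTP k))
  have hleastG := fun k => isLeast_leastMultiplier (α := α) hG hGs (hA0 k)
  have hleastH := fun k => isLeast_leastMultiplier (α := γ) hH hHs (hP0 k)
  have hGdual := fun k => hG.mem_subdiff_of_mem_multipliers (hA0 k) (hPdis k) (hleastG k).1
  have hHdual := fun k => hH.mem_subdiff_of_mem_multipliers (hP0 k) (hr.disposal k) (hleastH k).1
  have hmonoP : Monotone fun k => leastMultiplier G α (μA k) := monotone_nat_of_le_succ fun k =>
    leastMultiplier_antitone hG hGs (hA0 (k + 1)) (hA (Nat.le_succ k))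
  -- The comparison passes through the capacity `μT k ≤ μP (k + 1)`: as `μT k` is a subgradient at
  -- its own adjusted prices, the multiplier of round `k` is also one for the capacity `μT k`.
  have hantiT : Antitone fun k => leastMultiplier H γ (μP k) := antitone_nat_of_succ_le fun k =>
    (leastMultiplier_antitone hH hHs (hT0 k) (hTP' k)).trans
      ((isLeast_leastMultiplier hH hHs (hT0 k)).2
        (hH.mem_multipliers_of_mem_subdiff (hleastH k).1.1 (hHdual k).1))
  have hτP0 : 0 ≤ τP := ge_of_tendsto' hτP fun j => (hleastG (φ j)).1.1
  have hτT0 : 0 ≤ τT := ge_of_tendsto' hτT fun j => (hleastH (φ j)).1.1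
  have hμT : Tendsto (fun j => μT (φ j)) atTop (𝓝 μ) := by
    have h := hμ.sub ((hr.tendsto_sub_zero hA0 hA).comp hφ.tendsto_atTop)
    rw [sub_zero] at h
    refine h.congr fun j => ?_
    simp only [Function.comp_apply, sub_sub_cancel]
  have hσP0 : 0 ≤ {i | μ i < nG i}.indicator τP :=
    fun i => Set.indicator_apply_nonneg fun _ => hτP0 i
  have hσT0 : 0 ≤ {i | μ i < nH i}.indicator τT :=
    fun i => Set.indicator_apply_nonneg fun _ => hτT0 i
  have hslack : ∀ i, {i | μ i < nG i}.indicator τP i = 0 ∨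
      {i | μ i < nH i}.indicator τT i = 0 := by
    intro i
    by_contra! hcon
    have hmG := Set.mem_of_indicator_ne_zero hcon.1
    have hmH := Set.mem_of_indicator_ne_zero hcon.2
    rw [Set.indicator_of_mem hmG, Set.indicator_of_mem hmH] at hcon
    have hPpos : 0 < τP i := lt_of_le_of_ne (hτP0 i) hcon.1.symm
    have hTpos : 0 < τT i := lt_of_le_of_ne (hτT0 i) hcon.2.symm
    -- A positive limit of a decreasing sequence makes every `τ^{T,k}` positive at `i`, so slackness
    -- excludes any rejection there in any round.
    have hTk : ∀ k, μT k i = μP k i := fun k => by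
      refine (hHdual k).2 i (hTpos.trans_le (le_of_tendsto (tendsto_pi_nhds.1 hτT i) ?_))
      filter_upwards [hφ.tendsto_atTop.eventually_ge_atTop k] with j hj
      exact hantiT hj i
    have hAk : ∀ k, μA k i = (nG ⊓ nH) i := fun k => by
      induction k with
      | zero => rw [hr.init]
      | succ k ih =>
        rw [hr.update k]
        simp only [Pi.sub_apply, hTk k, sub_self, sub_zero, ih]
    have hlim : Tendsto (fun j => μP (φ j) i) atTop (𝓝 ((nG ⊓ nH) i)) := by
      refine tendsto_const_nhds.congr' ?_
      filter_upwards [(tendsto_pi_nhds.1 hτP i).eventually (lt_mem_nhds hPpos)] with j hj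
      rw [(hGdual (φ j)).2 i hj, hAk]
    have hμi : μ i = (nG ⊓ nH) i := tendsto_nhds_unique (tendsto_pi_nhds.1 hμ i) hlim
    have h1 : μ i < (nG ⊓ nH) i := lt_inf_iff.2 ⟨hmG, hmH⟩
    exact absurd hμi h1.ne
  refine ⟨reduce_ne_top hσP0, reduce_ne_top hσT0, fun i => ?_,
    hG.mem_subdiff_indicator hnG hτP0 (hG.mem_subdiff_of_tendsto
      (fun j => (hleastG (φ j)).1.1) (fun j => (hGdual (φ j)).1) hμ hτP),
    hH.mem_subdiff_indicator hnH hτT0 (hH.mem_subdiff_of_tendsto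
      (fun j => (hleastH (φ j)).1.1) (fun j => (hHdual (φ j)).1) hμT hτT)⟩
  rw [reduce, reduce, coe_sub_sub_self, coe_sub_sub_self]
  rcases hslack i with h | h
  · rw [h, neg_zero]
    exact max_eq_left (EReal.neg_le_zero.2 (hσT0 i))
  · rw [h, neg_zero]
    exact max_eq_right (EReal.neg_le_zero.2 (hσP0 i))

end Algorithm

end AggDA

/-! ### Well-definedness, convergence and existence combined. -/

theorem mainTheorem2 {X Y : Type*} [Fintype X] [Fintype Y]
    (G H : (X × Y → ℝ) → EReal)
    (hG : AggDA.IsWelfare G) (hGsub : AggDA.IsSubmodular G)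
    (hH : AggDA.IsWelfare H) (hHsub : AggDA.IsSubmodular H)
    (α γ : X × Y → ℝ) :
    (∀ nG ∈ upperBounds (AggDA.dom (AggDA.conj G)),
      ∀ nH ∈ upperBounds (AggDA.dom (AggDA.conj H)),
      -- whatever maximizers were chosen before, every phase of the algorithm can be carried out,
      -- and the multipliers have least elements
      (∀ A T : X × Y → ℝ, AggDA.Reachable G H α γ nG nH A T →
        (AggDA.proposals G α T A).Nonempty ∧
        IsLeast (AggDA.multipliers G α A) (AggDA.leastMultiplier G α A) ∧
        ∀ P ∈ AggDA.proposals G α T A,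
          (AggDA.disposals H γ P).Nonempty ∧
          IsLeast (AggDA.multipliers H γ P) (AggDA.leastMultiplier H γ P)) ∧
      (∃ μA μP μT : ℕ → X × Y → ℝ, AggDA.IsRun G H α γ nG nH μA μP μT) ∧
      -- convergence, for every run of the algorithm
      (∀ μA μP μT : ℕ → X × Y → ℝ, AggDA.IsRun G H α γ nG nH μA μP μT →
        (∃ φ : ℕ → ℕ, StrictMono φ ∧
          ∃ (μ : X × Y → ℝ) (τP τT : X × Y → EReal),
            Tendsto (fun j => μP (φ j)) atTop (𝓝 μ) ∧
            Tendsto (fun j => AggDA.leastMultiplier G α (μA (φ j))) atTop (𝓝 τP) ∧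
            Tendsto (fun j => AggDA.leastMultiplier H γ (μP (φ j))) atTop (𝓝 τT)) ∧
        (∀ φ : ℕ → ℕ, StrictMono φ →
          ∀ (μ : X × Y → ℝ) (τP τT : X × Y → EReal),
            Tendsto (fun j => μP (φ j)) atTop (𝓝 μ) →
            Tendsto (fun j => AggDA.leastMultiplier G α (μA (φ j))) atTop (𝓝 τP) →
            Tendsto (fun j => AggDA.leastMultiplier H γ (μP (φ j))) atTop (𝓝 τT) →
            AggDA.IsGenEquilibrium G H α γ μ
              (AggDA.reduce α ({i | μ i < nG i}.indicator τP))
              (AggDA.reduce γ ({i | μ i < nH i}.indicator τT))))) ∧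
    -- existence of generalized equilibrium matchings
    (∃ (μ : X × Y → ℝ) (U V : X × Y → EReal), AggDA.IsGenEquilibrium G H α γ μ U V) := by
  refine ⟨fun nG hnG nH hnH => ⟨fun A T hAT => ?_, AggDA.exists_isRun hG hGsub hH hnG hnH,
    fun μA μP μT hr => ⟨hr.exists_convergent hG, fun φ hφ μ τP τT hμ hτP hτT =>
      hr.isGenEquilibrium hG hGsub hH hHsub hnG hnH hφ hμ hτP hτT⟩⟩, ?_⟩
  · obtain ⟨hT0, hTA, Q, hQ, hTQ⟩ := hAT.invariant hG hGsub hH hnG hnH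
    refine ⟨⟨Q, AggDA.mem_proposals_of_mem_disposals hQ hTQ⟩,
      AggDA.isLeast_leastMultiplier hG hGsub (hT0.trans hTA), fun P hP => ?_⟩
    have hP0 : 0 ≤ P := hT0.trans hP.1.1
    exact ⟨hH.disposals_nonempty hP0, AggDA.isLeast_leastMultiplier hH hHsub hP0⟩
  · obtain ⟨nG, hnG⟩ := hG.compact_dom.isBounded.bddAbove
    obtain ⟨nH, hnH⟩ := hH.compact_dom.isBounded.bddAbove
    obtain ⟨μA, μP, μT, hr⟩ := AggDA.exists_isRun (α := α) (γ := γ) hG hGsub hH hnG hnH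
    obtain ⟨φ, hφ, μ, τP, τT, hμ, hτP, hτT⟩ := hr.exists_convergent hG
    exact ⟨μ, _, _, hr.isGenEquilibrium hG hGsub hH hHsub hnG hnH hφ hμ hτP hτT⟩
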